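/- Let $P\subset\mathbb R^2$ be a nondegenerate convex polygon with vertices $v_0,\dots,v_{p-1}$ ($p\ge 3$) listed counterclockwise, indices mod $p$, and let $X=\mathbb R^2\setminus P$. For each $i$ let $R_i$ be the open ray extending the side $v_iv_{i+1}$ beyond $v_i$. The rays $R_i$ divide $X$ into cells $X_0,\dots,X_{p-1}$, closed in $X$: $X_i$ is the set of $x\in X$ such that $P$ lies on the left of the oriented line from $x$ to $v_i$ (points of this line allowed). The outer billiard about $P$ maps $x\in X_i$ to $2v_i-x$; on a ray, which belongs to two cells, both images are admitted. A point $x\in X$ is *regular* if all points of its forward orbit lie in $X\setminus\bigcup_i R_i$. A point $x$ is *periodic* if there are $n\ge1$ and an orbit $x=x_0,x_1,\dots,x_n=x$; the least such $n$ is its period $\operatorname{per}(x)$. Let $X_{\mathrm{per}}$ be the set of periodic points, $X_\infty$ the set of regular points, and $V_n=\{x\in X_{\mathrm{per}}:\operatorname{per}(x)\le n\}$. Let $|\cdot|$ be any norm on $\mathbb R^2$. 1. There are constants $C,R>0$ such that $|x|\le C\,\operatorname{per}(x)$ for all $x\in X_{\mathrm{per}}$ with $|x|\ge R$. 2. Suppose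 that $P$ is rational, that is, the subgroup of $\mathbb R^2$ generated by the side vectors $v_{i+1}-v_i$ has rank $2$. Then every regular point is periodic, and there are constants $c,C,R>0$ such that $c|x|\le \operatorname{per}(x)\le C|x|$ for all $x\in X_\infty$ with $|x|\ge R$. Moreover, the sets $V_n$ are measurable with finite area, and there are constants $c',C'>0$ such that $c'n^2\le\operatorname{area}(V_n)\le C'n^2$ for all sufficiently large $n$. -/

import Mathlib

open Filter Asymptotics MeasureTheory

noncomputable section

namespace OuterBilliard

/-- The Euclidean plane. -/
abbrev Plane : Type := EuclideanSpace ℝ (Fin 2)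

/-- The oriented area `u ∧ w` of a pair of vectors; it is positive iff `w` points to the
left of `u`. -/
def cross (u w : Plane) : ℝ := u 0 * w 1 - u 1 * w 0

/-- `v 0, v 1, …, v (p - 1)` are the vertices of a (nondegenerate) convex `p`-gon, listed
counterclockwise (indices are cyclic): `p ≥ 3`, and all the other vertices lie strictly to
the left of each directed side from `v i` to `v (i + 1)`. -/
def IsConvexPolygon {p : ℕ} [NeZero p] (v : Fin p → Plane) : Prop :=
  3 ≤ p ∧ ∀ i j : Fin p, j ≠ i → j ≠ i + 1 → 0 < cross (v (i + 1) - v i) (v j - v i)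

/-- The closed region bounded by the polygon. -/
def body {p : ℕ} (v : Fin p → Plane) : Set Plane := convexHull ℝ (Set.range v)

/-- The polygon is rational: the abelian group generated by the translations in its sides
has rank two. -/
def IsRationalPolygon {p : ℕ} [NeZero p] (v : Fin p → Plane) : Prop :=
  Module.finrank ℤ (Submodule.span ℤ (Set.range fun i : Fin p => v (i + 1) - v i)) = 2

/-- The phase space `X`: the complement of the polygon. -/
def phaseSpace {p : ℕ} (v : Fin p → Plane) : Set Plane := (body v)ᶜ

/-- The ray extending the side from `v i` to `v (i + 1)` beyond `v i`. -/
def ray {p : ℕ} [NeZero p] (v : Fin p → Plane) (i : Fin p) : Set Plane :=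
  {x | ∃ t : ℝ, 0 < t ∧ x = v i + t • (v i - v (i + 1))}

/-- The cell of the vertex `v i`, closed in `X`: the points `x` outside the polygon such that
the oriented line from `x` to `v i` supports the polygon and has it on its left. These are
the pieces into which the rays `ray v i` divide `X`; neighbouring cells share a ray. -/
def cell {p : ℕ} (v : Fin p → Plane) (i : Fin p) : Set Plane :=
  {x | x ∈ phaseSpace v ∧ ∀ j : Fin p, 0 ≤ cross (v i - x) (v j - x)}

/-- The outer billiard map as a relation: `x` goes to its reflection in the vertex `v i` if `x`
is in the cell of `v i`. It is single-valued off the rays; on a ray both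
adjacent branches are admitted. -/
def Step {p : ℕ} (v : Fin p → Plane) (x y : Plane) : Prop :=
  ∃ i : Fin p, x ∈ cell v i ∧ y = (2 : ℝ) • v i - x

/-- `x` is regular: the whole forward orbit of `x` stays in the open faces, that is, in `X` and
off all the rays. -/
def IsRegular {p : ℕ} [NeZero p] (v : Fin p → Plane) (x : Plane) : Prop :=
  ∀ y, Relation.ReflTransGen (Step v) x y → y ∈ phaseSpace v ∧ ∀ i, y ∉ ray v i

/-- The set of regular points. -/
def regularPoints {p : ℕ} [NeZero p] (v : Fin p → Plane) : Set Plane := {x | IsRegular v x}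

/-- The positive times after which an orbit of `x` returns to `x`. -/
def returnTimes {p : ℕ} (v : Fin p → Plane) (x : Plane) : Set ℕ :=
  {n | 0 < n ∧ ∃ s : ℕ → Plane, s 0 = x ∧ s n = x ∧ ∀ k < n, Step v (s k) (s (k + 1))}

/-- The set of periodic points of the outer billiard. -/
def periodicPoints {p : ℕ} (v : Fin p → Plane) : Set Plane := {x | (returnTimes v x).Nonempty}

/-- The (least) period of a periodic point (and `0` at the other points). -/
def period {p : ℕ} (v : Fin p → Plane) (x : Plane) : ℕ := sInf (returnTimes v x)

/-- The set of periodic points of period at most `n`. -/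
def periodAtMost {p : ℕ} (v : Fin p → Plane) (n : ℕ) : Set Plane :=
  {x | x ∈ periodicPoints v ∧ period v x ≤ n}

end OuterBilliard

end

namespace OuterBilliard

/-! ### Oriented areas in the plane. -/

section Cross

/-! Two successive reflections, in `v i` and then in `v j`, compose to the translation by `2 • (v j
- v i)`. Up to a bounded error this pair maximizes `cross (v l - v k) x` (`cross_le_of_mem_cell`).
The maximum, `width`, is comparable with the norm, so far from the polygon the second iterate
circulates roughly along the level curves of `width`, parallel to their edges.

Part 1 needs no arithmetic. In a time short compared with `width v x` the orbit stays relatively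
close to `x`, so each double step has positive area against `x`; these areas add up and the orbit
cannot close (`width_le_of_closed_orbit`).

In the rational case the areas of pairs of differences of vertices are multiples of one unit
(`Grid`). At equally spaced large heights `h` the steps divide the edges of the level curve `width =
h` exactly. Translates of the polygon placed along the curve, the beads of a necklace, then move
each to the next under the second iterate (`Grid.exists_next_bead`, `bead_cell`,
`bead_reflect_cell`). A regular orbit can cross the height `h` only by entering the necklace, which
is invariant (`inNecklace_of_crossing`, `InNecklace.succ`). So the width varies by a bounded amount
along regular orbits (`Grid.exists_width_confined`). Every second point lies in an annulus of
bounded thickness, where its areas against the differences are discrete; this leaves linearly many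
positions, and the pigeonhole principle with injectivity gives a return in linear time
(`Grid.exists_returnTime_le`).

The area estimates follow by comparison with discs of radius of order `n`, since almost every point
outside the polygon is regular (`IsConvexPolygon.volume_not_regular`). -/

theorem cross_add_left (a b c : Plane) : cross (a + b) c = cross a c + cross b c := by
  simp only [cross, PiLp.add_apply]; ring

theorem cross_add_right (a b c : Plane) : cross a (b + c) = cross a b + cross a c := by
  simp only [cross, PiLp.add_apply]; ring

theorem cross_sub_left (a b c : Plane) : cross (a - b) c = cross a c - cross b c := by
  simp only [cross, PiLp.sub_apply]; ring

theorem cross_sub_right (a b c : Plane) : cross a (b - c) = cross a b - cross a c := by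
  simp only [cross, PiLp.sub_apply]; ring

theorem cross_smul_left (t : ℝ) (a b : Plane) : cross (t • a) b = t * cross a b := by
  simp only [cross, PiLp.smul_apply, smul_eq_mul]; ring

theorem cross_smul_right (t : ℝ) (a b : Plane) : cross a (t • b) = t * cross a b := by
  simp only [cross, PiLp.smul_apply, smul_eq_mul]; ring

theorem cross_neg_left (a b : Plane) : cross (-a) b = -cross a b := by
  simp only [cross, PiLp.neg_apply]; ring

theorem cross_neg_right (a b : Plane) : cross a (-b) = -cross a b := by
  simp only [cross, PiLp.neg_apply]; ring

theorem cross_self (a : Plane) : cross a a = 0 := by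
  simp only [cross]; ring

theorem cross_swap (a b : Plane) : cross a b = -cross b a := by
  simp only [cross]; ring

theorem cross_zero_left (a : Plane) : cross 0 a = 0 := by
  simp [cross]

theorem cross_zero_right (a : Plane) : cross a 0 = 0 := by
  simp [cross]

/-- Cramer's rule. -/
theorem cramer (p q x : Plane) : cross p q • x = cross x q • p + cross p x • q := by
  ext i
  fin_cases i <;>
    simp only [cross, PiLp.add_apply, PiLp.smul_apply, smul_eq_mul, Fin.zero_eta, Fin.mk_one] <;> ring

theorem abs_cross_le (u w : Plane) : |cross u w| ≤ ‖u‖ * ‖w‖ := by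
  refine abs_le_of_sq_le_sq ?_ (by positivity)
  rw [mul_pow, EuclideanSpace.norm_sq_eq, EuclideanSpace.norm_sq_eq]
  simp only [Fin.sum_univ_two, Real.norm_eq_abs, sq_abs, cross]
  nlinarith [sq_nonneg (u 0 * w 0 + u 1 * w 1)]

theorem continuous_cross : Continuous fun z : Plane × Plane => cross z.1 z.2 := by
  unfold cross
  fun_prop

theorem eq_zero_of_cross_eq_zero {u w x : Plane} (h : cross u w ≠ 0) (hu : cross u x = 0)
    (hw : cross w x = 0) : x = 0 := by
  have := cramer u w x
  rw [hu, cross_swap x w, hw] at this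
  simpa [h] using this

/-- `cross u` as a linear functional. -/
def crossL (u : Plane) : Plane →ₗ[ℝ] ℝ where
  toFun := cross u
  map_add' := cross_add_right u
  map_smul' t w := by simpa using cross_smul_right t u w

@[simp] theorem crossL_apply (u w : Plane) : crossL u w = cross u w := rfl

end Cross

/-! ### The width, a norm adapted to the polygon. -/

section Width

variable {p : ℕ} (v : Fin p → Plane)

/-- The width of the polygon in a direction: the largest of the values `cross (v l - v k) y`. -/
noncomputable def width (y : Plane) : ℝ := ⨆ kl : Fin p × Fin p, cross (v kl.2 - v kl.1) y

theorem le_width (k l : Fin p) (y : Plane) : cross (v l - v k) y ≤ width v y :=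
  le_ciSup (f := fun kl : Fin p × Fin p => cross (v kl.2 - v kl.1) y)
    (Set.finite_range _).bddAbove (k, l)

theorem abs_cross_le_width (i j : Fin p) (y : Plane) : |cross (v j - v i) y| ≤ width v y := by
  refine abs_le.2 ⟨?_, le_width v i j y⟩
  have := le_width v j i y
  rw [← neg_sub, cross_neg_left] at this
  linarith

theorem exists_width_eq [NeZero p] (y : Plane) : ∃ k l, cross (v l - v k) y = width v y := by
  obtain ⟨kl, h⟩ := exists_eq_ciSup_of_finite (f := fun kl : Fin p × Fin p =>
    cross (v kl.2 - v kl.1) y)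
  exact ⟨kl.1, kl.2, h⟩

theorem width_nonneg [NeZero p] (y : Plane) : 0 ≤ width v y := by
  simpa [cross_zero_left] using le_width v 0 0 y

theorem exists_norm_le : ∃ B, 0 < B ∧ ∀ i, ‖v i‖ ≤ B := by
  obtain ⟨B, hB⟩ := (Set.finite_range fun i => ‖v i‖).bddAbove
  exact ⟨max B 1, by positivity, fun i => (hB ⟨i, rfl⟩).trans (le_max_left _ _)⟩

variable {v}

theorem norm_diff_le {B : ℝ} (hB : ∀ i, ‖v i‖ ≤ B) (i j : Fin p) : ‖v j - v i‖ ≤ 2 * B :=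
  (norm_sub_le _ _).trans (by linarith [hB i, hB j])

theorem abs_cross_diff_le {B : ℝ} (hB : ∀ i, ‖v i‖ ≤ B) (i j : Fin p) (y : Plane) :
    |cross (v j - v i) y| ≤ 2 * B * ‖y‖ :=
  (abs_cross_le _ _).trans (mul_le_mul_of_nonneg_right (norm_diff_le hB i j) (norm_nonneg y))

theorem abs_cross_diff_diff_le {B : ℝ} (hB : ∀ i, ‖v i‖ ≤ B) (i j k l : Fin p) :
    |cross (v j - v i) (v l - v k)| ≤ 4 * B ^ 2 := by
  have h0 : 0 ≤ B := (norm_nonneg _).trans (hB i)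
  refine (abs_cross_diff_le hB i j _).trans ?_
  nlinarith [norm_diff_le hB k l]

theorem width_neg [NeZero p] (y : Plane) : width v (-y) = width v y := by
  have key : ∀ z, width v z ≤ width v (-z) := fun z => by
    obtain ⟨k, l, h⟩ := exists_width_eq v z
    have := le_width v l k (-z)
    rw [← h]
    refine le_trans (le_of_eq ?_) this
    rw [cross_neg_right, ← cross_neg_left, neg_sub]
  refine le_antisymm ?_ (key y)
  simpa using key (-y)

theorem width_le_add [NeZero p] {B : ℝ} (hB : ∀ i, ‖v i‖ ≤ B) (x y : Plane) :
    width v x ≤ width v y + 2 * B * ‖x - y‖ := by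
  obtain ⟨k, l, h⟩ := exists_width_eq v x
  have h1 := le_width v k l y
  have h2 := (abs_le.1 (abs_cross_diff_le hB k l (x - y))).2
  rw [cross_sub_right] at h2
  linarith

theorem width_zero [NeZero p] : width v 0 = 0 := by
  obtain ⟨k, l, h⟩ := exists_width_eq v 0
  rw [← h, cross_zero_right]

theorem width_le_norm [NeZero p] {B : ℝ} (hB : ∀ i, ‖v i‖ ≤ B) (x : Plane) :
    width v x ≤ 2 * B * ‖x‖ := by
  simpa [width_zero] using width_le_add hB x 0

/-- Three of the points `v i` are not on a line. -/
def Nondegenerate (v : Fin p → Plane) : Prop :=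
  ∃ a b c, cross (v b - v a) (v c - v a) ≠ 0

theorem IsConvexPolygon.exists_side_pos [NeZero p] (hv : IsConvexPolygon v) (i : Fin p) :
    ∃ j, 0 < cross (v (i + 1) - v i) (v j - v i) := by
  obtain ⟨hp, h⟩ := hv
  obtain ⟨j, hj⟩ : ∃ j : Fin p, j ∉ ({i, i + 1} : Finset (Fin p)) := by
    by_contra! hcon
    have : (Finset.univ : Finset (Fin p)) ⊆ {i, i + 1} := fun j _ => hcon j
    have := (Finset.card_le_card this).trans Finset.card_le_two
    simp at this
    omega
  simp only [Finset.mem_insert, Finset.mem_singleton, not_or] at hj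
  exact ⟨j, h i j hj.1 hj.2⟩

theorem IsConvexPolygon.nondegenerate [NeZero p] (hv : IsConvexPolygon v) : Nondegenerate v := by
  obtain ⟨j, hj⟩ := hv.exists_side_pos 0
  exact ⟨0, 0 + 1, j, hj.ne'⟩

/-- Cramer's rule recovers `x` from its areas against two independent differences of vertices, and
the width bounds both areas. -/
theorem Nondegenerate.exists_le_width [NeZero p] (hv : Nondegenerate v) :
    ∃ c, 0 < c ∧ ∀ x, c * ‖x‖ ≤ width v x := by
  obtain ⟨i, j, k, hD⟩ := hv
  set e := v j - v i
  set f := v k - v i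
  have he : 0 < ‖e‖ + ‖f‖ := by
    have : e ≠ 0 := fun h => hD (by rw [h, cross_zero_left])
    have := norm_pos_iff.2 this
    positivity
  have hD' : 0 < |cross e f| := abs_pos.2 hD
  refine ⟨|cross e f| / (‖e‖ + ‖f‖), by positivity, fun x => ?_⟩
  have h1 : |cross e x| ≤ width v x := abs_cross_le_width v i j x
  have h2 : |cross x f| ≤ width v x := by
    rw [cross_swap, abs_neg]
    exact abs_cross_le_width v i k x
  have h3 : |cross e f| * ‖x‖ ≤ |cross x f| * ‖e‖ + |cross e x| * ‖f‖ := by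
    rw [← Real.norm_eq_abs, ← norm_smul, cramer e f x, ← Real.norm_eq_abs, ← Real.norm_eq_abs,
      ← norm_smul, ← norm_smul]
    exact norm_add_le _ _
  rw [div_mul_eq_mul_div, div_le_iff₀ he]
  nlinarith [norm_nonneg e, norm_nonneg f]

end Width

/-! ### Successive cells and the width. -/

section Cells

variable {p : ℕ} {v : Fin p → Plane}

theorem mem_cell_iff {x : Plane} {i : Fin p} :
    x ∈ cell v i ↔ x ∈ phaseSpace v ∧ ∀ k, 0 ≤ cross (v k - v i) (x - v i) := by
  have : ∀ k, cross (v i - x) (v k - x) = cross (v k - v i) (x - v i) := fun k => by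
    simp only [cross, PiLp.sub_apply]; ring
  simp only [cell, Set.mem_ofPred_eq, this]

/-- Twice the area of the triangle `x`, `v i`, `v j`. -/
def level (v : Fin p → Plane) (i j : Fin p) (x : Plane) : ℝ := cross (v j - v i) (x - v i)

/-- Lets two successive levels of an orbit be compared as functions of the same middle point. -/
theorem level_reflect (i j : Fin p) (x : Plane) :
    level v j i ((2 : ℝ) • v i - x) = level v i j x := by
  simp only [level, cross, PiLp.sub_apply, PiLp.smul_apply, smul_eq_mul]; ring

/-- Up to a bounded error, two successive cells realize the width. -/
theorem cross_le_of_mem_cell {B : ℝ} (hB : ∀ i, ‖v i‖ ≤ B) {x : Plane} {i j : Fin p}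
    (hi : x ∈ cell v i) (hj : (2 : ℝ) • v i - x ∈ cell v j) (k l : Fin p) :
    cross (v l - v k) x ≤ cross (v j - v i) x + 8 * B ^ 2 := by
  have h0 : 0 ≤ B := (norm_nonneg _).trans (hB i)
  -- Tangency at `x` says that `v i` nearly minimizes `cross (v k) x` over `k`; tangency at the
  -- reflected point, which is nearly `-x`, says that `v j` nearly maximizes it.
  have h1 := (mem_cell_iff.1 hi).2 k
  have h2 := (mem_cell_iff.1 hj).2 l
  have e1 : cross (v l - v j) ((2 : ℝ) • v i - x - v j) =
      cross (v l - v j) (v i) + cross (v l - v j) (v i - v j) - cross (v l - v j) x := by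
    simp only [cross, PiLp.sub_apply, PiLp.smul_apply, smul_eq_mul]; ring
  have b1 := abs_le.1 (abs_cross_diff_le hB j l (v i))
  have b2 := abs_le.1 (abs_cross_diff_diff_le hB j l j i)
  have b3 := abs_le.1 (abs_cross_diff_le hB i k (v i))
  have b4 : 2 * B * ‖v i‖ ≤ 2 * B ^ 2 := by nlinarith [hB i]
  rw [cross_sub_right] at h1
  have e2 : cross (v l - v k) x =
      cross (v j - v i) x + cross (v l - v j) x - cross (v k - v i) x := by
    simp only [cross, PiLp.sub_apply]; ring
  linarith [b1.2, b2.2, b3.1]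

theorem width_le_of_mem_cell [NeZero p] {B : ℝ} (hB : ∀ i, ‖v i‖ ≤ B) {x : Plane} {i j : Fin p}
    (hi : x ∈ cell v i) (hj : (2 : ℝ) • v i - x ∈ cell v j) :
    width v x ≤ cross (v j - v i) x + 8 * B ^ 2 := by
  obtain ⟨k, l, h⟩ := exists_width_eq v x
  exact h ▸ cross_le_of_mem_cell hB hi hj k l

theorem abs_level_sub_width_le [NeZero p] {B : ℝ} (hB : ∀ i, ‖v i‖ ≤ B) {x : Plane} {i j : Fin p}
    (hi : x ∈ cell v i) (hj : (2 : ℝ) • v i - x ∈ cell v j) :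
    |level v i j x - width v x| ≤ 10 * B ^ 2 := by
  have h0 : 0 ≤ B := (norm_nonneg _).trans (hB i)
  have h1 := width_le_of_mem_cell hB hi hj
  have h2 := le_width v i j x
  have b1 := abs_le.1 (abs_cross_diff_le hB i j (v i))
  have b4 : 2 * B * ‖v i‖ ≤ 2 * B ^ 2 := by nlinarith [hB i]
  rw [level, cross_sub_right, abs_le]
  constructor <;> nlinarith [b1.1, b1.2]

end Cells

/-! ### Periods grow at least linearly. -/

section LowerBound

variable {p : ℕ} {v : Fin p → Plane}

/-- Doubling the period makes the number of steps even, so that the orbit can be read in pairs of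
reflections. -/
theorem exists_periodic_extension {x : Plane} {n : ℕ} (h : n ∈ returnTimes v x) :
    ∃ s : ℕ → Plane, s 0 = x ∧ s (2 * n) = x ∧ ∀ k, Step v (s k) (s (k + 1)) := by
  obtain ⟨hn, s, h0, h1, hs⟩ := h
  refine ⟨fun k => s (k % n), by simpa using h0, by simpa using h0, fun k => ?_⟩
  have hk := Nat.mod_lt k hn
  have := hs _ hk
  rcases Nat.lt_or_ge (k % n + 1) n with hlt | hge
  · have e : (k + 1) % n = k % n + 1 := by
      rw [Nat.add_mod, Nat.mod_eq_of_lt (a := 1) (by omega), Nat.mod_eq_of_lt hlt]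
    simpa only [e] using this
  · have e1 : k % n + 1 = n := by omega
    have e : (k + 1) % n = 0 := by
      rw [← Nat.mod_add_div k n, add_right_comm, e1]; simp
    simp only [e]
    rw [e1, h1, ← h0] at this
    exact this

theorem period_mem {x : Plane} (h : x ∈ periodicPoints v) : period v x ∈ returnTimes v x :=
  Nat.sInf_mem h

variable [NeZero p]

/-- A far orbit of even length which is short compared with the width at its starting point
does not close up. -/
theorem width_le_of_closed_orbit {B : ℝ} (hB : ∀ i, ‖v i‖ ≤ B) {s : ℕ → Plane}
    {n : ℕ} (hn : 0 < n) (hs : ∀ k, Step v (s k) (s (k + 1))) (hc : s (2 * n) = s 0) :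
    width v (s 0) ≤ 8 * B ^ 2 + 16 * B ^ 2 * n := by
  have hB0 : 0 ≤ B := (norm_nonneg _).trans (hB 0)
  have two : ∀ k, ∃ i j, s (2 * (k + 1)) = s (2 * k) + (2 : ℝ) • (v j - v i) ∧
      width v (s (2 * k)) ≤ cross (v j - v i) (s (2 * k)) + 8 * B ^ 2 := fun k => by
    obtain ⟨i, hi, ei⟩ := hs (2 * k)
    obtain ⟨j, hj, ej⟩ := hs (2 * k + 1)
    refine ⟨i, j, ?_, width_le_of_mem_cell hB hi (ei ▸ hj)⟩
    rw [mul_add, mul_one, ej, ei, smul_sub]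
    abel
  have dist : ∀ k, ‖s (2 * k) - s 0‖ ≤ 4 * B * k := fun k => by
    induction k with
    | zero => simp
    | succ k ih =>
      obtain ⟨i, j, e, -⟩ := two k
      have : s (2 * (k + 1)) - s 0 = (s (2 * k) - s 0) + (2 : ℝ) • (v j - v i) := by
        rw [e]; abel
      rw [this]
      refine (norm_add_le _ _).trans ?_
      rw [norm_smul, Real.norm_two]
      push_cast
      linarith [norm_diff_le hB i j]
  by_contra! hlt
  -- The pair chosen at `s (2 * k)` nearly realizes the width there; the small drift from `s 0`
  -- leaves its area against `s 0` positive.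
  have step : ∀ k < n, cross (s (2 * k)) (s 0) < cross (s (2 * (k + 1))) (s 0) := fun k hk => by
    obtain ⟨i, j, e, hw⟩ := two k
    rw [e, cross_add_left, cross_smul_left]
    have h1 := width_le_add hB (s 0) (s (2 * k))
    rw [norm_sub_rev] at h1
    have h2 := (abs_le.1 (abs_cross_diff_le hB i j (s (2 * k) - s 0))).2
    rw [cross_sub_right] at h2
    have h3 : 2 * B * ‖s (2 * k) - s 0‖ ≤ 8 * B ^ 2 * n := by
      have h4 : (k : ℝ) ≤ n := by exact_mod_cast hk.le
      calc 2 * B * ‖s (2 * k) - s 0‖ ≤ 2 * B * (4 * B * k) := by gcongr; exact dist k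
        _ = 8 * B ^ 2 * k := by ring
        _ ≤ 8 * B ^ 2 * n := by gcongr
    linarith
  have mono : ∀ k ≤ n, 0 < k → cross (s 0) (s 0) < cross (s (2 * k)) (s 0) := by
    intro k
    induction k with
    | zero => intro _ h; exact absurd h (lt_irrefl _)
    | succ k ih =>
      intro hk _
      rcases Nat.eq_zero_or_pos k with rfl | h
      · simpa using step 0 (by omega)
      · exact (ih (by omega) h).trans (step k (by omega))
  have := mono n le_rfl hn
  rw [hc] at this
  exact lt_irrefl _ this

theorem Nondegenerate.norm_le_period (hv : Nondegenerate v) :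
    ∃ C, 0 < C ∧ ∀ x ∈ periodicPoints v, ‖x‖ ≤ C * period v x := by
  obtain ⟨c, hc, hw⟩ := hv.exists_le_width
  obtain ⟨B, hB0, hB⟩ := exists_norm_le v
  -- `24 = 8 + 16`, as the period is at least one.
  refine ⟨24 * B ^ 2 / c, by positivity, fun x hx => ?_⟩
  have hn := period_mem hx
  obtain ⟨s, h0, h1, hs⟩ := exists_periodic_extension hn
  have := width_le_of_closed_orbit hB hn.1 hs (h1.trans h0.symm)
  rw [h0] at this
  have h1 : (1 : ℝ) ≤ period v x := by exact_mod_cast hn.1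
  rw [div_mul_eq_mul_div, le_div_iff₀ hc]
  nlinarith [hw x]

end LowerBound

/-! ### Tangent lines, cells and rays. -/

section Tangents

variable {p : ℕ} {v : Fin p → Plane}

theorem vertex_mem_body (i : Fin p) : v i ∈ body v := subset_convexHull _ _ ⟨i, rfl⟩

theorem body_subset_of_forall_le {f : Plane →ₗ[ℝ] ℝ} {r : ℝ} (h : ∀ i, r ≤ f (v i)) :
    ∀ x ∈ body v, r ≤ f x := by
  refine fun x hx => convexHull_min ?_ (convex_halfSpace_ge f.isLinear r) hx
  rintro _ ⟨i, rfl⟩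
  exact h i

theorem isCompact_body : IsCompact (body v) := (Set.finite_range v).isCompact_convexHull (𝕜 := ℝ)

theorem norm_le_of_mem_body {B : ℝ} (hB : ∀ i, ‖v i‖ ≤ B) {x : Plane} (hx : x ∈ body v) :
    ‖x‖ ≤ B := by
  have : body v ⊆ Metric.closedBall 0 B := by
    refine convexHull_min ?_ (convex_closedBall _ _)
    rintro _ ⟨i, rfl⟩
    simpa using hB i
  simpa using this hx

/-- Every point outside the polygon has a tangent line with the polygon on its left. -/
theorem exists_mem_cell [NeZero p] {x : Plane} (hx : x ∈ phaseSpace v) : ∃ i, x ∈ cell v i := by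
  obtain ⟨f, u, hu, hf⟩ := geometric_hahn_banach_point_closed (convex_convexHull ℝ _)
    (isCompact_body (v := v)).isClosed hx
  have hpos : ∀ i, 0 < f (v i - x) := fun i => by
    rw [map_sub, sub_pos]
    exact hu.trans (hf _ (vertex_mem_body i))
  set a := f (EuclideanSpace.single 0 1)
  set b := f (EuclideanSpace.single 1 1)
  have fe : ∀ w : Plane, f w = w 0 * a + w 1 * b := fun w => by
    have : w = w 0 • EuclideanSpace.single (0 : Fin 2) (1 : ℝ) +
        w 1 • EuclideanSpace.single (1 : Fin 2) (1 : ℝ) := by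
      ext i; fin_cases i <;> simp
    conv_lhs => rw [this]
    simp [a, b]
  let g : Plane → ℝ := fun w => a * w 1 - b * w 0
  have hid : ∀ u w : Plane, cross u w * (a ^ 2 + b ^ 2) = f u * g w - g u * f w := fun u w => by
    rw [fe, fe]; simp only [g, cross]; ring
  have hab : 0 < a ^ 2 + b ^ 2 := by
    by_contra! h
    have ha : a = 0 := by nlinarith [sq_nonneg a, sq_nonneg b]
    have hb : b = 0 := by nlinarith [sq_nonneg a, sq_nonneg b]
    have := hpos 0
    rw [fe, ha, hb] at this
    simp at this
  -- The polygon lies in the half-plane `0 < f` seen from `x`, so the vertex of least slope `g / f`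
  -- is the tangent vertex.
  obtain ⟨i, hi⟩ := Finite.exists_min fun i => g (v i - x) / f (v i - x)
  refine ⟨i, hx, fun j => ?_⟩
  have h1 := hi j
  rw [div_le_div_iff₀ (hpos i) (hpos j)] at h1
  have h2 := hid (v i - x) (v j - x)
  by_contra! h3
  nlinarith

variable [NeZero p]

theorem IsConvexPolygon.injective (hv : IsConvexPolygon v) {i j : Fin p} (hij : v i = v j) :
    i = j := by
  by_contra hne
  have hne' : j ≠ i := fun h => hne h.symm
  by_cases hj : j = i + 1
  · subst hj
    obtain ⟨k, this⟩ := hv.exists_side_pos i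
    rw [← hij, sub_self, cross_zero_left] at this
    exact lt_irrefl _ this
  · have := hv.2 i j hne' hj
    rw [← hij, sub_self, cross_zero_right] at this
    exact lt_irrefl _ this

theorem IsConvexPolygon.side_nonneg (hv : IsConvexPolygon v) (i j : Fin p) :
    0 ≤ cross (v (i + 1) - v i) (v j - v i) := by
  by_cases h1 : j = i
  · rw [h1, sub_self, cross_zero_right]
  by_cases h2 : j = i + 1
  · rw [h2, cross_self]
  exact (hv.2 i j h1 h2).le

theorem IsConvexPolygon.side_eq_zero (hv : IsConvexPolygon v) {i j : Fin p} (hij : j ≠ i)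
    (h : cross (v (i + 1) - v i) (v j - v i) = 0) : j = i + 1 := by
  by_contra h2
  exact (hv.2 i j hij h2).ne' h

/-- Off the rays, the tangent line to the polygon at the vertex of the cell meets no other
vertex. -/
theorem IsConvexPolygon.eq_of_cross_eq_zero (hv : IsConvexPolygon v) {x : Plane} {i j : Fin p}
    (hi : x ∈ cell v i) (hr : ∀ k, x ∉ ray v k) (h0 : cross (v j - v i) (x - v i) = 0) :
    i = j := by
  by_contra hne
  have hne' : j ≠ i := fun h => hne h.symm
  obtain ⟨hx, hc⟩ := mem_cell_iff.1 hi
  have hu : v i - x ≠ 0 := fun h => hx (by rw [← sub_eq_zero.1 h]; exact vertex_mem_body i)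
  obtain ⟨u, rfl⟩ : ∃ u, x = v i - u := ⟨v i - x, by abel⟩
  have hu : u ≠ 0 := by simpa using hu
  have hc' : ∀ k, 0 ≤ cross u (v k - v i) := fun k => by
    have := hc k
    rw [sub_sub_cancel_left, cross_neg_right, ← cross_swap] at this
    exact this
  have h0' : cross u (v j - v i) = 0 := by
    rw [sub_sub_cancel_left, cross_neg_right, ← cross_swap] at h0
    exact h0
  obtain ⟨τ, hτ⟩ : ∃ τ : ℝ, v j - v i = τ • u := by
    have hn : u 0 ^ 2 + u 1 ^ 2 ≠ 0 := fun h => hu (by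
      ext k; fin_cases k
      · show u 0 = 0
        nlinarith [sq_nonneg (u 0), sq_nonneg (u 1)]
      · show u 1 = 0
        nlinarith [sq_nonneg (u 0), sq_nonneg (u 1)])
    generalize v j - v i = w at h0'
    refine ⟨(u 0 * w 0 + u 1 * w 1) / (u 0 ^ 2 + u 1 ^ 2), ?_⟩
    have hc : u 0 * w 1 = u 1 * w 0 := by simpa [cross, sub_eq_zero] using h0'
    ext k; fin_cases k
    · show w 0 = _ * u 0
      field_simp
      linear_combination (-u 1) * hc
    · show w 1 = _ * u 1
      field_simp
      linear_combination (u 0) * hc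
  have hτ0 : τ ≠ 0 := by
    rintro rfl
    rw [zero_smul, sub_eq_zero] at hτ
    exact hne' (hv.injective hτ)
  -- The other vertex lies before `v i` or beyond it as seen along the line from `x`. Either way the
  -- line carries a side, and `x` is on that side or on its ray.
  rcases lt_or_gt_of_ne hτ0 with hneg | hpos
  · have h1 : 0 ≤ cross (v (j + 1) - v j) (v i - v j) := hv.side_nonneg j i
    have e1 : v i - v j = (-τ) • u := by rw [neg_smul, ← hτ]; abel
    rw [e1, cross_smul_right] at h1
    have h2 : cross u (v (j + 1) - v j) = cross u (v (j + 1) - v i) := by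
      have : v (j + 1) - v j = (v (j + 1) - v i) - (v j - v i) := by abel
      rw [this, cross_sub_right, h0', sub_zero]
    have h3 := hc' (j + 1)
    rw [← h2, cross_swap] at h3
    have h4 : cross (v (j + 1) - v j) u = 0 := by nlinarith
    have hi' : i = j + 1 := hv.side_eq_zero hne (by rw [e1, cross_smul_right, h4, mul_zero])
    rw [← hi'] at h2 h3 h4
    have hvu : v i = v j - τ • u := by rw [← hτ]; abel
    by_cases hle : 1 ≤ -τ
    · refine hx ?_
      have hseg : v i - u = (1 + τ⁻¹) • v i + (-τ⁻¹) • v j := by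
        have : v j = v i + τ • u := by rw [← hτ]; abel
        rw [this, smul_add, smul_smul, neg_mul, inv_mul_cancel₀ hτ0]
        module
      rw [hseg]
      have hinv : -τ⁻¹ ≤ 1 := by
        rw [← inv_neg]; exact inv_le_one_of_one_le₀ hle
      exact convex_convexHull ℝ _ (vertex_mem_body i) (vertex_mem_body j) (by linarith)
        (by rw [← inv_neg]; positivity) (by ring)
    · refine hr j ⟨(-τ)⁻¹ - 1, ?_, ?_⟩
      · rw [sub_pos]
        exact (one_lt_inv₀ (by linarith)).2 (by linarith)
      · rw [← hi', hvu, sub_sub_cancel, smul_smul, sub_mul, one_mul, inv_neg, neg_mul,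
          inv_mul_cancel₀ hτ0]
        module
  · have h1 := hv.side_nonneg i j
    rw [hτ, cross_smul_right] at h1
    have h3 := hc' (i + 1)
    rw [cross_swap] at h3
    have h4 : cross (v (i + 1) - v i) u = 0 := by nlinarith
    have hj : j = i + 1 := hv.side_eq_zero hne' (by rw [hτ, cross_smul_right, h4, mul_zero])
    refine hr i ⟨τ⁻¹, by positivity, ?_⟩
    rw [← hj, ← neg_sub (v j), hτ, smul_neg, smul_smul, inv_mul_cancel₀ hτ0, one_smul]
    abel

/-- Off the rays, the reflection in the vertex of the cell stays outside the polygon. -/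
theorem IsConvexPolygon.reflect_mem_phaseSpace (hv : IsConvexPolygon v) {x : Plane} {i : Fin p}
    (hi : x ∈ cell v i) (hr : ∀ k, x ∉ ray v k) : (2 : ℝ) • v i - x ∈ phaseSpace v := by
  obtain ⟨hx, hc⟩ := mem_cell_iff.1 hi
  intro hy
  -- The tangent line touches the polygon at `v i` only; the rest of the polygon is strictly to its
  -- left, while the reflected point is on the line.
  have hsub : body v ⊆ {w | w = v i ∨ 0 < cross (v i - x) (w - v i)} := by
    refine convexHull_min ?_ (convex_iff_forall_pos.2 ?_)
    · rintro _ ⟨j, rfl⟩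
      have h1 : cross (v i - x) (v j - v i) = cross (v j - v i) (x - v i) := by
        simp only [cross, PiLp.sub_apply]; ring
      rcases (hc j).lt_or_eq with h | h
      · exact Or.inr (h1 ▸ h)
      · exact Or.inl (by rw [hv.eq_of_cross_eq_zero hi hr h.symm])
    · intro w hw w' hw' a b ha hb hab
      have h1 : cross (v i - x) (a • w + b • w' - v i) =
          a * cross (v i - x) (w - v i) + b * cross (v i - x) (w' - v i) := by
        rw [← cross_smul_right, ← cross_smul_right, ← cross_add_right]
        congr 1
        obtain rfl : b = 1 - a := by linarith
        module
      rcases hw with rfl | hw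
      · rcases hw' with rfl | hw'
        · exact Or.inl (by rw [← add_smul, hab, one_smul])
        · refine Or.inr ?_
          rw [h1, sub_self, cross_zero_right]
          positivity
      · refine Or.inr ?_
        rw [h1]
        rcases hw' with rfl | hw'
        · rw [sub_self, cross_zero_right]
          positivity
        · positivity
  rcases hsub hy with h | h
  · refine hx ?_
    have : x = v i := by
      have h2 : (2 : ℝ) • v i - x = v i + (v i - x) := by rw [two_smul]; abel
      rw [h2, add_eq_left, sub_eq_zero] at h
      exact h.symm
    rw [this]
    exact vertex_mem_body i
  · have h2 : (2 : ℝ) • v i - x - v i = v i - x := by rw [two_smul]; abel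
    rw [h2, cross_self] at h
    exact lt_irrefl _ h

end Tangents

/-! ### Regular orbits and their injectivity. -/

section RegularOrbits

variable {p : ℕ} {v : Fin p → Plane}

/-- An orbit `s` with itinerary `a` which stays off the boundaries of the cells. -/
structure RegularOrbit (v : Fin p → Plane) (s : ℕ → Plane) (a : ℕ → Fin p) : Prop where
  mem : ∀ k, s k ∈ cell v (a k)
  succ : ∀ k, s (k + 1) = (2 : ℝ) • v (a k) - s k
  strict : ∀ k i, cross (v i - v (a k)) (s k - v (a k)) = 0 → a k = i

theorem IsRegular.exists_regularOrbit [NeZero p] (hv : IsConvexPolygon v) {x : Plane}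
    (hx : IsRegular v x) : ∃ s a, s 0 = x ∧ RegularOrbit v s a := by
  have hex : ∀ y : {y // Relation.ReflTransGen (Step v) x y}, ∃ i, y.1 ∈ cell v i :=
    fun y => exists_mem_cell (hx y.1 y.2).1
  choose c hc using hex
  let T : {y // Relation.ReflTransGen (Step v) x y} → {y // Relation.ReflTransGen (Step v) x y} :=
    fun y => ⟨(2 : ℝ) • v (c y) - y.1, y.2.tail ⟨c y, hc y, rfl⟩⟩
  let S : ℕ → {y // Relation.ReflTransGen (Step v) x y} := fun k => T^[k] ⟨x, .refl⟩
  refine ⟨fun k => (S k).1, fun k => c (S k), rfl, fun k => hc _, fun k => ?_, fun k i h => ?_⟩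
  · simp only [S, Function.iterate_succ_apply', T]
  · exact hv.eq_of_cross_eq_zero (hc (S k)) (hx _ (S k).2).2 h

variable {s : ℕ → Plane} {a : ℕ → Fin p}

theorem RegularOrbit.eq_of_forall_nonneg (ho : RegularOrbit v s a) {k : ℕ} {i : Fin p}
    (hi : ∀ j, 0 ≤ cross (v j - v i) (s k - v i)) : a k = i := by
  refine ho.strict k i (le_antisymm ?_ ((mem_cell_iff.1 (ho.mem k)).2 i))
  have := hi (a k)
  have e : cross (v i - v (a k)) (s k - v (a k)) = -cross (v (a k) - v i) (s k - v i) := by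
    simp only [cross, PiLp.sub_apply]; ring
  linarith

/-- For two preimages of one point, reflected in `v (a k)` and `v (a l)`, the tangency areas are
opposite numbers, both nonnegative, hence zero; strictness then identifies the vertices. -/
theorem RegularOrbit.injective_step (ho : RegularOrbit v s a) {k l : ℕ}
    (h : s (k + 1) = s (l + 1)) : s k = s l := by
  have hk := (mem_cell_iff.1 (ho.mem k)).2 (a l)
  have hl := (mem_cell_iff.1 (ho.mem l)).2 (a k)
  have hs := h
  rw [ho.succ, ho.succ] at h
  have e : s l = (2 : ℝ) • v (a l) - ((2 : ℝ) • v (a k) - s k) := by rw [h]; abel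
  have e1 : cross (v (a k) - v (a l)) (s l - v (a l)) =
      -cross (v (a l) - v (a k)) (s k - v (a k)) := by
    rw [e]
    simp only [cross, PiLp.sub_apply, PiLp.smul_apply, smul_eq_mul]; ring
  have := ho.strict k (a l) (by linarith)
  rw [e, this]
  abel

theorem RegularOrbit.add_two (ho : RegularOrbit v s a) (k : ℕ) :
    s (k + 2) = s k + (2 : ℝ) • (v (a (k + 1)) - v (a k)) := by
  rw [ho.succ, ho.succ, smul_sub]
  abel

/-- Injectivity pulls a coincidence back to time `0`. -/
theorem RegularOrbit.mem_returnTimes (ho : RegularOrbit v s a) {k l : ℕ} (hkl : k < l)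
    (h : s k = s l) : l - k ∈ returnTimes v (s 0) := by
  have : ∀ k d, s k = s (k + d) → s 0 = s d := fun k d => by
    induction k with
    | zero => intro h; simpa using h
    | succ k ih =>
      intro h
      rw [add_right_comm] at h
      exact ih (ho.injective_step h)
  refine ⟨by omega, s, rfl, (this k (l - k) (by rw [h]; congr 1; omega)).symm, fun k _ => ?_⟩
  exact ⟨a k, ho.mem k, ho.succ k⟩

end RegularOrbits

/-! ### Arithmetic of the necklace. -/

section Grid

variable {p : ℕ} {v : Fin p → Plane}

/-- The oriented areas spanned by differences of vertices are integer multiples of `ω`, and all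
the nonzero multiples divide `m`. -/
structure Grid (v : Fin p → Plane) (ω : ℝ) (m : ℤ) : Prop where
  unit_pos : 0 < ω
  mult_pos : 0 < m
  int : ∀ i j k l, ∃ n : ℤ, cross (v j - v i) (v l - v k) = n * ω ∧ (n ≠ 0 → n ∣ m)

theorem exists_grid {ω : ℝ} (hω : 0 < ω)
    (h : ∀ i j k l, ∃ n : ℤ, cross (v j - v i) (v l - v k) = n * ω) : ∃ m, Grid v ω m := by
  choose n hn using h
  -- Vanishing areas contribute a factor `1`, which keeps the product positive.
  let f : Fin p × Fin p × Fin p × Fin p → ℤ := fun q =>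
    if n q.1 q.2.1 q.2.2.1 q.2.2.2 = 0 then 1 else |n q.1 q.2.1 q.2.2.1 q.2.2.2|
  refine ⟨∏ q, f q, hω, Finset.prod_pos fun q _ => ?_, fun i j k l => ⟨n i j k l, hn i j k l,
    fun h0 => ?_⟩⟩
  · simp only [f]
    split_ifs with h0
    · exact one_pos
    · exact abs_pos.2 h0
  · have : f (i, j, k, l) = |n i j k l| := if_neg h0
    exact (dvd_abs _ _).2 dvd_rfl |>.trans (this ▸ Finset.dvd_prod_of_mem f (Finset.mem_univ _))

variable {ω : ℝ} {m : ℤ}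

/-- The lattice of the vectors whose oriented areas with differences of vertices are multiples
of `2 * m * ω`. -/
def InPhase (v : Fin p → Plane) (ω : ℝ) (m : ℤ) (c : Plane) : Prop :=
  ∀ k l, ∃ z : ℤ, cross c (v l - v k) = 2 * m * ω * z

/-- The translation vectors of the beads `b + P` of the necklace at height `h`. -/
structure IsBead (v : Fin p → Plane) (ω : ℝ) (m : ℤ) (h : ℝ) (b : Plane) : Prop where
  le : ∀ k l, cross (v l - v k) b ≤ h
  phase : ∃ i j, cross (v j - v i) b = h ∧
    ∃ t : ℤ, InPhase v ω m (b - (2 * t : ℝ) • (v j - v i))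

theorem InPhase.neg {c : Plane} (h : InPhase v ω m c) : InPhase v ω m (-c) := fun k l => by
  obtain ⟨z, hz⟩ := h k l
  exact ⟨-z, by rw [cross_neg_left, hz]; push_cast; ring⟩

theorem InPhase.sub {c d : Plane} (hc : InPhase v ω m c) (hd : InPhase v ω m d) :
    InPhase v ω m (c - d) := fun k l => by
  obtain ⟨z, hz⟩ := hc k l
  obtain ⟨y, hy⟩ := hd k l
  exact ⟨z - y, by rw [cross_sub_left, hz, hy]; push_cast; ring⟩

theorem IsBead.neg {h : ℝ} {b : Plane} (hb : IsBead v ω m h b) : IsBead v ω m h (-b) := by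
  obtain ⟨i, j, hij, t, ht⟩ := hb.phase
  refine ⟨fun k l => ?_, j, i, ?_, t, ?_⟩
  · rw [cross_neg_right, ← cross_neg_left, neg_sub]
    exact hb.le l k
  · rw [cross_neg_right, ← cross_neg_left, neg_sub, hij]
  · convert ht.neg using 1
    module

/-- The corners of the necklace are in phase. -/
theorem Grid.inPhase_of_corner (hg : Grid v ω m) {h : ℝ} {N : ℤ} (hh : h = 2 * m ^ 2 * ω * N)
    (hpos : 0 < h) {b : Plane} {i j k l : Fin p} (h1 : cross (v j - v i) b = h)
    (h2 : cross (v l - v k) b = h) (hne : v j - v i ≠ v l - v k) : InPhase v ω m b := by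
  obtain ⟨n, hn, hdvd⟩ := hg.int i j k l
  have hω := hg.unit_pos
  set u := v j - v i
  set w := v l - v k
  have hc := cramer u w b
  rw [cross_swap b w, h1, h2, hn] at hc
  have hn0 : n ≠ 0 := by
    rintro rfl
    rw [Int.cast_zero, zero_mul, zero_smul, neg_smul, neg_add_eq_sub, ← smul_sub] at hc
    exact hne (sub_eq_zero.1 ((smul_eq_zero.1 hc.symm).resolve_left hpos.ne')).symm
  obtain ⟨m', hm'⟩ := hdvd hn0
  intro k' l'
  obtain ⟨z1, hz1, -⟩ := hg.int i j k' l'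
  obtain ⟨z2, hz2, -⟩ := hg.int k l k' l'
  -- One factor `m` of `h` pays for the division by `n` in Cramer's rule; the other is kept for the
  -- phase.
  refine ⟨m' * N * (z2 - z1), ?_⟩
  have h3 := congrArg (fun x => cross x (v l' - v k')) hc
  simp only [cross_smul_left, cross_add_left] at h3
  rw [hz1, hz2, hh] at h3
  have hn' : (n : ℝ) * ω ≠ 0 := mul_ne_zero (by exact_mod_cast hn0) hω.ne'
  apply mul_left_cancel₀ hn'
  rw [h3, hm']
  push_cast
  ring

/-- The beads advance along the necklace. -/
theorem Grid.exists_next_bead (hg : Grid v ω m) {h : ℝ} {N : ℤ} (hh : h = 2 * m ^ 2 * ω * N)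
    (hpos : 0 < h) {b : Plane} (hb : IsBead v ω m h b) :
    ∃ i j, cross (v j - v i) b = h ∧ IsBead v ω m h (b + (2 : ℝ) • (v j - v i)) := by
  have hω := hg.unit_pos
  obtain ⟨i₀, j₀, h₀, t₀, ht₀⟩ := hb.phase
  let S := {q : Fin p × Fin p // cross (v q.2 - v q.1) b = h}
  have : Nonempty S := ⟨⟨(i₀, j₀), h₀⟩⟩
  -- If several pairs are tight at `b`, the least inner product with `b` selects the outgoing edge:
  -- no tight functional grows along it.
  let f : Plane → ℝ := fun u => b 0 * u 0 + b 1 * u 1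
  obtain ⟨⟨⟨i, j⟩, hij⟩, hmin⟩ := Finite.exists_min fun q : S => f (v q.1.2 - v q.1.1)
  simp only at hij hmin
  have hsel : ∀ k l, cross (v l - v k) b = h → cross (v l - v k) (v j - v i) ≤ 0 := by
    intro k l hkl
    have h1 := hmin ⟨(k, l), hkl⟩
    simp only at h1
    have hid : ∀ u w : Plane, cross w u * (b 0 ^ 2 + b 1 ^ 2) = cross w b * f u - cross u b * f w :=
      fun u w => by simp only [f, cross]; ring
    have h2 := hid (v j - v i) (v l - v k)
    rw [hij, hkl] at h2
    by_contra! h3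
    have h4 : 0 < b 0 ^ 2 + b 1 ^ 2 := by
      by_contra! h4
      have hb0 : b 0 = 0 := by nlinarith [sq_nonneg (b 0), sq_nonneg (b 1)]
      have hb1 : b 1 = 0 := by nlinarith [sq_nonneg (b 0), sq_nonneg (b 1)]
      rw [cross, hb0, hb1] at hij
      linarith
    nlinarith
  obtain ⟨t, ht⟩ : ∃ t : ℤ, InPhase v ω m (b - (2 * t : ℝ) • (v j - v i)) := by
    by_cases he : v j - v i = v j₀ - v i₀
    · exact ⟨t₀, he ▸ ht₀⟩
    · exact ⟨0, by simpa using hg.inPhase_of_corner hh hpos hij h₀ he⟩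
  have hij' : cross (v j - v i) (b + (2 : ℝ) • (v j - v i)) = h := by
    rw [cross_add_right, cross_smul_right, cross_self, mul_zero, add_zero, hij]
  refine ⟨i, j, hij, fun k l => ?_, i, j, hij', t + 1, ?_⟩
  -- Overshooting would place a corner at `b + (2 * θ) • u` with `0 < θ < 1`. Corners are in phase,
  -- and this forces `θ` to be an integer.
  · by_contra! hgt
    rw [cross_add_right, cross_smul_right] at hgt
    have hlt : cross (v l - v k) b < h := by
      refine lt_of_le_of_ne (hb.le k l) fun he => ?_
      linarith [hsel k l he]
    set u := v j - v i
    set w := v l - v k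
    have hwu : 0 < cross w u := by linarith
    set θ := (h - cross w b) / (2 * cross w u)
    have hθ0 : 0 < θ := div_pos (by linarith) (by linarith)
    have hθ1 : θ < 1 := (div_lt_one (by linarith)).2 (by linarith)
    have hθ : 2 * θ * cross w u = h - cross w b := by
      simp only [θ]; field_simp
    have hne : u ≠ w := fun he => by rw [he, cross_self] at hwu; exact lt_irrefl _ hwu
    have hc : InPhase v ω m (b + (2 * θ) • u) := by
      refine hg.inPhase_of_corner hh hpos (i := i) (j := j) (k := k) (l := l) ?_ ?_ hne
      · rw [cross_add_right, cross_smul_right, cross_self, mul_zero, add_zero, hij]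
      · rw [cross_add_right, cross_smul_right, hθ]
        ring
    obtain ⟨z, hz⟩ := hc.sub ht k l
    obtain ⟨n, hn, hdvd⟩ := hg.int i j k l
    have e : b + (2 * θ) • u - (b - (2 * t : ℝ) • u) = (2 * (θ + t)) • u := by module
    rw [e, cross_smul_left, hn] at hz
    have hn0 : n ≠ 0 := by
      rintro rfl
      rw [cross_swap, neg_pos] at hwu
      change cross u w = _ at hn
      rw [hn] at hwu
      simp at hwu
    obtain ⟨m', hm'⟩ := hdvd hn0
    rw [hm'] at hz
    have hn' : (2 : ℝ) * n * ω ≠ 0 :=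
      mul_ne_zero (mul_ne_zero two_ne_zero (by exact_mod_cast hn0)) hω.ne'
    have h5 : θ = ((m' * z - t : ℤ) : ℝ) := by
      push_cast at hz ⊢
      have : θ + t = m' * z := by
        apply mul_left_cancel₀ hn'
        linarith
      linarith
    rw [h5] at hθ0 hθ1
    have a1 : (0 : ℤ) < m' * z - t := by exact_mod_cast hθ0
    have a2 : m' * z - t < (1 : ℤ) := by exact_mod_cast hθ1
    omega
  · convert ht using 1
    push_cast
    module

end Grid

/-! ### A whole bead shares its two cells. -/

section BeadCells

variable {p : ℕ} {v : Fin p → Plane} {B h : ℝ} {b : Plane} {i j : Fin p}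

/-- A bead about to advance along `v j - v i` lies in the cell of `v i`. -/
theorem bead_cell (hB : ∀ i, ‖v i‖ ≤ B) (hpos : 0 < h) (hh : 8 * B ^ 2 ≤ h)
    (hij : cross (v j - v i) b = h) (h1 : ∀ k l, cross (v l - v k) b ≤ h)
    (h2 : ∀ k l, cross (v l - v k) (b + (2 : ℝ) • (v j - v i)) ≤ h) {x : Plane} (hx : x ∈ body v)
    (k : Fin p) : 0 ≤ cross (v k - v i) (b + x - v i) := by
  -- The condition is affine in `x`, so the vertices suffice.
  suffices ∀ m, cross (v k - v i) (v i - b) ≤ crossL (v k - v i) (v m) by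
    have := body_subset_of_forall_le this x hx
    rw [crossL_apply, cross_sub_right] at this
    rw [cross_sub_right, cross_add_right]
    linarith
  intro m
  rw [crossL_apply]
  set α := cross (v k - v i) b with hα
  set Q := cross (v k - v i) (v j - v i) with hQ
  set β := cross (v m - v i) (v k - v i) with hβ
  set γ := cross (v m - v i) (v j - v i) with hγ
  suffices β ≤ α by
    have e : cross (v k - v i) (v i - b) = cross (v k - v i) (v m) + β - α := by
      simp only [hα, hβ, cross, PiLp.sub_apply]; ring
    linarith
  have hα0 : 0 ≤ α := by
    have := h1 k j
    have e : cross (v j - v k) b = cross (v j - v i) b - α := by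
      simp only [hα, cross, PiLp.sub_apply]; ring
    linarith
  have hα2 : 0 ≤ α + 2 * Q := by
    have := h2 k j
    have e : cross (v j - v k) (b + (2 : ℝ) • (v j - v i)) =
        cross (v j - v i) b - (α + 2 * Q) := by
      simp only [hα, hQ, cross, PiLp.sub_apply, PiLp.add_apply, PiLp.smul_apply, smul_eq_mul]; ring
    linarith
  have hm1 : 0 ≤ cross (v m - v i) b := by
    have := h1 m j
    have e : cross (v j - v m) b = cross (v j - v i) b - cross (v m - v i) b := by
      simp only [cross, PiLp.sub_apply]; ring
    linarith
  have hm2 : 0 ≤ h - cross (v m - v i) b := by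
    have := h1 i m
    linarith
  -- Plücker's relation for four plane vectors. It bounds `β` by `α`, since `γ ≤ h / 2` and, the
  -- next bead being at height at most `h` too, `-Q ≤ α / 2`.
  have hid : Q * cross (v m - v i) b = -h * β + α * γ := by
    rw [← hij]
    simp only [hα, hβ, hγ, hQ, cross, PiLp.sub_apply]; ring
  have hγ' : γ ≤ 4 * B ^ 2 := (abs_le.1 (abs_cross_diff_diff_le hB i m i j)).2
  rcases le_or_gt 0 Q with hQ0 | hQ0
  · have : h * β ≤ α * h := by nlinarith [mul_nonneg hQ0 hm1, mul_le_mul_of_nonneg_left hγ' hα0]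
    nlinarith
  · have hQm : Q * (h - cross (v m - v i) b) ≤ 0 := mul_nonpos_of_nonpos_of_nonneg hQ0.le hm2
    have h3 : h * β ≤ h * (-Q) + α * (h / 2) := by
      nlinarith [mul_le_mul_of_nonneg_left hγ' hα0]
    have h4 : h * β ≤ h * α := by nlinarith
    exact le_of_mul_le_mul_left h4 hpos

/-- The reflection in `v i` of a bead about to advance along `v j - v i` lies in the cell
of `v j`. -/
theorem bead_reflect_cell {ω : ℝ} {m : ℤ} (hg : Grid v ω m)
    (hB : ∀ i, ‖v i‖ ≤ B) (hpos : 0 < h) (hh : 8 * B ^ 2 ≤ h) (hh' : 32 * B ^ 4 ≤ h * ω)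
    (hij : cross (v j - v i) b = h) (h1 : ∀ k l, cross (v l - v k) b ≤ h)
    (h2 : ∀ k l, cross (v l - v k) (b + (2 : ℝ) • (v j - v i)) ≤ h) {x : Plane} (hx : x ∈ body v)
    (k : Fin p) : 0 ≤ cross (v k - v j) ((2 : ℝ) • v i - (b + x) - v j) := by
  suffices ∀ m, cross (v j - v k) ((2 : ℝ) • v i - b - v j) ≤ crossL (v j - v k) (v m) by
    have := body_subset_of_forall_le this x hx
    rw [crossL_apply] at this
    have e : cross (v k - v j) ((2 : ℝ) • v i - (b + x) - v j) =
      cross (v j - v k) x - cross (v j - v k) ((2 : ℝ) • v i - b - v j) := by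
      simp only [cross, PiLp.sub_apply, PiLp.add_apply, PiLp.smul_apply, smul_eq_mul]; ring
    linarith
  intro m'
  rw [crossL_apply]
  set α := cross (v j - v k) b with hα
  set Q := cross (v k - v j) (v j - v i) with hQ
  set β := cross (v k - v j) (v m' - v i) with hβ
  set γ := cross (v m' - v i) (v j - v i) with hγ
  suffices β + Q ≤ α by
    have e : cross (v j - v k) ((2 : ℝ) • v i - b - v j) =
        cross (v j - v k) (v m') + β + Q - α := by
      simp only [hα, hβ, hQ, cross, PiLp.sub_apply, PiLp.smul_apply, smul_eq_mul]; ring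
    linarith
  have hα0 : 0 ≤ α := by
    have := h1 i k
    have e : cross (v k - v i) b = cross (v j - v i) b - α := by
      simp only [hα, cross, PiLp.sub_apply]; ring
    linarith
  have hα2 : 2 * Q ≤ α := by
    have := h2 i k
    have e : cross (v k - v i) (b + (2 : ℝ) • (v j - v i)) =
        cross (v j - v i) b - (α - 2 * Q) := by
      simp only [hα, hQ, cross, PiLp.sub_apply, PiLp.add_apply, PiLp.smul_apply, smul_eq_mul]; ring
    linarith
  have hm1 : 0 ≤ cross (v m' - v i) b := by
    have := h1 m' j
    have e : cross (v j - v m') b = cross (v j - v i) b - cross (v m' - v i) b := by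
      simp only [cross, PiLp.sub_apply]; ring
    linarith
  have hm2 : 0 ≤ h - cross (v m' - v i) b := by
    have := h1 i m'
    linarith
  have hid : Q * cross (v m' - v i) b = h * β - α * γ := by
    rw [← hij]
    simp only [hα, hβ, hγ, hQ, cross, PiLp.sub_apply]; ring
  have hγ' : γ ≤ 4 * B ^ 2 := (abs_le.1 (abs_cross_diff_diff_le hB i m' i j)).2
  have hαγ := mul_le_mul_of_nonneg_left hγ' hα0
  rcases le_or_gt Q 0 with hQ0 | hQ0
  · have h3 : h * β ≤ h * α := by
      nlinarith [mul_nonpos_of_nonpos_of_nonneg hQ0 hm1]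
    have h4 := le_of_mul_le_mul_left h3 hpos
    linarith
  · rcases le_or_gt β Q with hβQ | hβQ
    · linarith
    · obtain ⟨n1, hn1, -⟩ := hg.int j k i j
      obtain ⟨n2, hn2, -⟩ := hg.int j k i m'
      have hω := hg.unit_pos
      -- Integrality enters here: a positive difference of areas is at least `ω`. By `hid` this
      -- makes `α` at least `8 * B ^ 2`, which exceeds `β + Q`.
      have hgap : ω ≤ β - Q := by
        rw [hQ, hβ, hn1, hn2] at hβQ ⊢
        have : n1 < n2 := by
          have := lt_of_mul_lt_mul_right hβQ hω.le
          exact_mod_cast this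
        have h5 : (n1 : ℝ) + 1 ≤ n2 := by exact_mod_cast this
        nlinarith
      have hβ' : β ≤ 4 * B ^ 2 := (abs_le.1 (abs_cross_diff_diff_le hB j k i m')).2
      have hQ' : Q ≤ 4 * B ^ 2 := (abs_le.1 (abs_cross_diff_diff_le hB j k i j)).2
      have hQm : 0 ≤ Q * (h - cross (v m' - v i) b) := mul_nonneg hQ0.le hm2
      have h3 : h * (β - Q) ≤ α * (4 * B ^ 2) := by nlinarith
      have h4 : h * ω ≤ α * (4 * B ^ 2) := (mul_le_mul_of_nonneg_left hgap hpos.le).trans h3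
      have h5 : 8 * B ^ 2 * (4 * B ^ 2) ≤ α * (4 * B ^ 2) := by nlinarith
      have hB2 : 0 < 4 * B ^ 2 := by linarith
      have := le_of_mul_le_mul_right h5 hB2
      linarith

end BeadCells

/-! ### Invariance of necklaces and crossings. -/

section Necklace

variable {p : ℕ} {v : Fin p → Plane} {ω : ℝ} {m : ℤ} {h : ℝ} {B : ℝ}
  {s : ℕ → Plane} {a : ℕ → Fin p}

/-- The point `s k` or its successor is in a bead of the necklace at height `h`. -/
def InNecklace (v : Fin p → Plane) (ω : ℝ) (m : ℤ) (h : ℝ) (s : ℕ → Plane) (k : ℕ) : Prop :=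
  ∃ b, IsBead v ω m h b ∧ (s k - b ∈ body v ∨ s (k + 1) - b ∈ body v)

/-- Necklaces are invariant. -/
theorem InNecklace.succ (hg : Grid v ω m) (hB : ∀ i, ‖v i‖ ≤ B) {N : ℤ}
    (hN : h = 2 * m ^ 2 * ω * N) (hpos : 0 < h) (hh : 8 * B ^ 2 ≤ h) (hh' : 32 * B ^ 4 ≤ h * ω)
    (ho : RegularOrbit v s a) {k : ℕ} (hk : InNecklace v ω m h s k) :
    InNecklace v ω m h s (k + 1) := by
  obtain ⟨b, hb, hx | hx⟩ := hk
  · obtain ⟨i, j, hij, hb'⟩ := hg.exists_next_bead hN hpos hb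
    have e0 : b + (s k - b) = s k := by abel
    have hi : a k = i := ho.eq_of_forall_nonneg fun l => by
      have := bead_cell hB hpos hh hij hb.le hb'.le hx l
      rwa [e0] at this
    have hj : a (k + 1) = j := ho.eq_of_forall_nonneg fun l => by
      have := bead_reflect_cell hg hB hpos hh hh' hij hb.le hb'.le hx l
      rwa [e0, ← hi, ← ho.succ] at this
    refine ⟨_, hb', Or.inr ?_⟩
    rw [show k + 1 + 1 = k + 2 from rfl, ho.add_two, hi, hj]
    convert hx using 1
    abel
  · exact ⟨b, hb, Or.inl hx⟩

theorem IsBead.width_eq [NeZero p] {b : Plane} (hb : IsBead v ω m h b) : width v b = h := by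
  obtain ⟨i, j, hij, -⟩ := hb.phase
  obtain ⟨k, l, hkl⟩ := exists_width_eq v b
  exact le_antisymm (hkl ▸ hb.le k l) (hij ▸ le_width v i j b)

/-- Beads sit on a level curve symmetric about the origin, and `s k` is within `3 * B` of it,
directly or after one reflection. -/
theorem InNecklace.abs_width_sub_le [NeZero p] (hB : ∀ i, ‖v i‖ ≤ B)
    (ho : RegularOrbit v s a) {k : ℕ} (hk : InNecklace v ω m h s k) :
    |width v (s k) - h| ≤ 6 * B ^ 2 := by
  have hB0 : 0 ≤ B := (norm_nonneg _).trans (hB 0)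
  obtain ⟨b, hb, hx⟩ := hk
  obtain ⟨c, hc, hsc⟩ : ∃ c, width v c = h ∧ ‖s k - c‖ ≤ 3 * B := by
    rcases hx with hx | hx
    · exact ⟨b, hb.width_eq, (norm_le_of_mem_body hB hx).trans (by linarith)⟩
    · refine ⟨-b, by rw [width_neg, hb.width_eq], ?_⟩
      have h1 := norm_le_of_mem_body hB hx
      have e : s k - -b = (2 : ℝ) • v (a k) - (s (k + 1) - b) := by rw [ho.succ]; abel
      rw [e]
      refine (norm_sub_le _ _).trans ?_
      rw [norm_smul, Real.norm_two]
      linarith [hB (a k)]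
  have h1 := width_le_add hB (s k) c
  have h2 := width_le_add hB c (s k)
  rw [norm_sub_rev] at h2
  have h3 : 2 * B * ‖s k - c‖ ≤ 6 * B ^ 2 := by nlinarith
  rw [hc] at h1 h2
  rw [abs_le]
  constructor <;> linarith

/-- The level of an orbit passes a necklace only through a bead. -/
theorem inNecklace_of_crossing (hg : Grid v ω m) (hB0 : 0 < B) (hB : ∀ i, ‖v i‖ ≤ B) {N : ℤ}
    (hN : h = 2 * m ^ 2 * ω * N) (hpos : 0 < h) (hh' : 100 * B ^ 4 ≤ h * ω)
    (ho : RegularOrbit v s a) {n : ℕ}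
    (hcr : ¬(level v (a n) (a (n + 1)) (s n) ≤ h ↔
      level v (a (n + 1)) (a (n + 2)) (s (n + 1)) ≤ h)) :
    InNecklace v ω m h s (n + 1) := by
  have hω := hg.unit_pos
  have c0 := mem_cell_iff.1 (ho.mem n)
  have c1 := ho.mem (n + 1)
  have c2 := ho.mem (n + 2)
  have hwid := cross_le_of_mem_cell hB c1 (by rw [← ho.succ]; exact c2)
  have hs2 : s (n + 2) = (2 : ℝ) • v (a (n + 1)) - s (n + 1) := ho.succ (n + 1)
  rw [← level_reflect (a n) (a (n + 1)) (s n), ← ho.succ] at hcr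
  have hs0 : s n = (2 : ℝ) • v (a n) - s (n + 1) := by rw [ho.succ]; abel
  have f1 := c0.2 (a (n + 2))
  have f2 := (mem_cell_iff.1 c2).2 (a n)
  rw [hs2] at f2
  rw [hs0] at f1
  unfold InNecklace
  rw [show n + 1 + 1 = n + 2 from rfl, hs2]
  generalize s (n + 1) = y at *
  generalize a n = i at *
  generalize a (n + 1) = j at *
  generalize a (n + 2) = l at *
  set P := v i - v j with hP
  set q := v l - v j with hq
  have hqP : v l - v i = q - P := by rw [hP, hq]; abel
  set D := cross P q with hD
  -- Tangency at `s n` and at `s (n + 2)`, rewritten at the middle point `y`, bounds the difference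
  -- of the two levels by `-D`; hence `D < 0` if they differ.
  have g1 : D ≤ cross (y - v j) (q - P) := by
    have e : cross (v l - v i) ((2 : ℝ) • v i - y - v i) = cross (y - v j) (q - P) - D := by
      simp only [hD, hP, hq, cross, PiLp.sub_apply, PiLp.smul_apply, smul_eq_mul]; ring
    linarith
  have g2 : cross (y - v j) (q - P) ≤ -D := by
    have e : cross (v i - v l) ((2 : ℝ) • v j - y - v l) = -cross (y - v j) (q - P) - D := by
      simp only [hD, hP, hq, cross, PiLp.sub_apply, PiLp.smul_apply, smul_eq_mul]; ring
    linarith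
  have hl1 : level v j i y = cross P (y - v j) := rfl
  have hl2 : level v j l y = cross q (y - v j) := rfl
  have hdiff : cross (y - v j) (q - P) = cross P (y - v j) - cross q (y - v j) := by
    simp only [cross, PiLp.sub_apply]; ring
  have hD0 : D < 0 := by
    by_contra! hD0
    have : cross P (y - v j) = cross q (y - v j) := by linarith
    rw [hl1, hl2, this] at hcr
    exact hcr Iff.rfl
  -- The intersection of the lines at height `h` parallel to `P` and `q`.
  set b := (h / D) • (q - P) with hb
  have hPb : cross P b = h := by
    rw [hb, cross_smul_right, cross_sub_right, cross_self, sub_zero, ← hD,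
      div_mul_cancel₀ _ hD0.ne]
  have hqb : cross q b = h := by
    rw [hb, cross_smul_right, cross_sub_right, cross_self, cross_swap q P, ← hD,
      zero_sub, neg_neg, div_mul_cancel₀ _ hD0.ne]
  set z := y - v j - b with hz
  have hPz : cross P z = level v j i y - h := by
    rw [hl1, hz, cross_sub_right P (y - v j) b, hPb]
  have hqz : cross q z = level v j l y - h := by
    rw [hl2, hz, cross_sub_right q (y - v j) b, hqb]
  have hzz : cross (y - v j) (q - P) = cross P z - cross q z := by
    rw [hdiff, hPz, hqz, hl1, hl2]; ring
  rw [hzz] at g1 g2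
  set β := cross P z / D with hβ
  set α := -cross q z / D with hα
  have hαβ : z = α • P + β • q := by
    have h1 := cramer P q z
    rw [← hD, cross_swap z q] at h1
    have h2 : z = D⁻¹ • (D • z) := by rw [smul_smul, inv_mul_cancel₀ hD0.ne, one_smul]
    rw [h2, h1, smul_add, smul_smul, smul_smul, hα, hβ, div_eq_inv_mul, div_eq_inv_mul]
  have hsum : α + β = (cross P z - cross q z) / D := by rw [hα, hβ]; ring
  have s1 : α + β ≤ 1 := by
    rw [hsum, div_le_iff_of_neg hD0]; linarith
  have s2 : -1 ≤ α + β := by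
    rw [hsum, le_div_iff_of_neg hD0]; linarith
  have tri : ∀ x y : ℝ, 0 ≤ x → 0 ≤ y → x + y ≤ 1 → v j + x • P + y • q ∈ body v := by
    intro x y hx hy hxy
    have hconv : Convex ℝ (body v) := convex_convexHull ℝ _
    have := hconv.sum_mem (t := Finset.univ) (w := ![1 - x - y, x, y]) (z := ![v j, v i, v l])
      (by intro k _; fin_cases k <;> simp <;> linarith) (by simp [Fin.sum_univ_three]; ring)
      (by intro k _; fin_cases k <;> exact vertex_mem_body _)
    rw [Fin.sum_univ_three] at this
    convert this using 1
    simp only [hP, hq, Matrix.cons_val]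
    module
  -- As `h` separates the levels, the coordinates have the same sign. With `|α + β| ≤ 1` this puts
  -- `y - v j - b` or its negative in the triangle spanned by `P` and `q`.
  have hcase : (0 ≤ α ∧ 0 ≤ β) ∨ (α ≤ 0 ∧ β ≤ 0) := by
    rw [not_iff] at hcr
    rcases le_or_gt (level v j l y) h with hle | hgt
    · have hgt := not_le.1 (hcr.2 hle)
      exact Or.inr ⟨div_nonpos_of_nonneg_of_nonpos (by linarith) hD0.le,
        div_nonpos_of_nonneg_of_nonpos (by linarith) hD0.le⟩
    · have hle : level v j i y ≤ h := by
        by_contra hcon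
        exact absurd (hcr.1 hcon) (not_le.2 hgt)
      exact Or.inl ⟨div_nonneg_of_nonpos (by linarith) hD0.le,
        div_nonneg_of_nonpos (by linarith) hD0.le⟩
  have hmem : y - b ∈ body v ∨ (2 : ℝ) • v j - y - -b ∈ body v := by
    have ey : y = v j + z + b := by rw [hz]; abel
    rcases hcase with ⟨hα0, hβ0⟩ | ⟨hα0, hβ0⟩
    · left
      have := tri α β hα0 hβ0 s1
      convert this using 1
      rw [ey, hαβ]; abel
    · right
      have := tri (-α) (-β) (by linarith) (by linarith) (by linarith)
      convert this using 1
      rw [ey, hαβ]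
      module
  have hyb : ‖y - b‖ ≤ 3 * B := by
    rcases hmem with hm | hm
    · exact (norm_le_of_mem_body hB hm).trans (by linarith)
    · have h1 := norm_le_of_mem_body hB hm
      have e : y - b = (2 : ℝ) • v j - ((2 : ℝ) • v j - y - -b) := by abel
      rw [e]
      refine (norm_sub_le _ _).trans ?_
      rw [norm_smul, Real.norm_two]
      linarith [hB j]
  have hbead : IsBead v ω m h b := by
    refine ⟨fun k l' => ?_, j, i, hPb, 0, ?_⟩
    -- The areas of differences of vertices against `b`, among them `h`, are multiples of `h * ω /
    -- (-D) ≥ 25 * B ^ 2`. Closeness to `y` allows an excess over `h` of at most `20 * B ^ 2`.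
    · by_contra! hgt
      have h1 := hwid k l'
      have h2 := (abs_le.1 (abs_cross_diff_le hB k l' (y - b))).1
      have h3 := (abs_le.1 (abs_cross_diff_le hB j l (y - b))).2
      rw [cross_sub_right] at h2 h3
      have h4 : 2 * B * ‖y - b‖ ≤ 6 * B ^ 2 := by nlinarith
      have h5 : cross (v l' - v k) b ≤ h + 20 * B ^ 2 := by linarith
      rw [hb, cross_smul_right, ← hqP] at hgt h5
      obtain ⟨n1, hn1, -⟩ := hg.int k l' i l
      obtain ⟨n2, hn2, -⟩ := hg.int j i j l
      rw [← hP, ← hq, ← hD] at hn2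
      rw [hn1] at hgt h5
      have hDB : -D ≤ 4 * B ^ 2 := by
        have := (abs_le.1 (abs_cross_diff_diff_le hB j i j l)).1
        linarith
      have h6 : h / D * (n1 * ω) = h + h * ω * (n2 - n1) / (-D) := by
        rw [hn2] at hD0 ⊢
        have hn2' : (n2 : ℝ) ≠ 0 := by rintro h0; rw [h0] at hD0; simp at hD0
        field_simp
        ring
      rw [h6] at hgt h5
      have hD1 : 0 < -D := by linarith
      have h7 : 0 < h * ω * (n2 - n1) / (-D) := by linarith
      have h8 : h * ω * (n2 - n1) / (-D) ≤ 20 * B ^ 2 := by linarith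
      rw [div_le_iff₀ hD1] at h8
      have h9 : 0 < h * ω * ((n2 : ℝ) - n1) := by
        have := mul_pos h7 hD1
        rwa [div_mul_cancel₀ _ hD1.ne'] at this
      have hhω : 0 < h * ω := mul_pos hpos hω
      have h10 : (0 : ℝ) < (n2 : ℝ) - n1 := (pos_iff_pos_of_mul_pos h9).1 hhω
      have h11 : (n1 : ℝ) + 1 ≤ n2 := by
        have : n1 < n2 := by exact_mod_cast sub_pos.1 h10
        exact_mod_cast this
      have hB4 : 0 < B ^ 4 := by positivity
      have h12 : h * ω * 1 ≤ h * ω * ((n2 : ℝ) - n1) :=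
        mul_le_mul_of_nonneg_left (by linarith) hhω.le
      have h13 : 20 * B ^ 2 * -D ≤ 20 * B ^ 2 * (4 * B ^ 2) :=
        mul_le_mul_of_nonneg_left hDB (by positivity)
      have h14 : 20 * B ^ 2 * (4 * B ^ 2) = 80 * B ^ 4 := by ring
      linarith
    · have hne : v i - v j ≠ v l - v j := fun he => by
        rw [← hP, ← hq] at he
        rw [hD, he, cross_self] at hD0
        exact lt_irrefl _ hD0
      simpa using hg.inPhase_of_corner hN hpos hPb hqb hne
  rcases hmem with hm | hm
  · exact ⟨b, hbead, Or.inl hm⟩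
  · exact ⟨-b, hbead.neg, Or.inr hm⟩

end Necklace

/-! ### Orbits are trapped between necklaces. -/

section Confinement

variable {p : ℕ} {v : Fin p → Plane} {ω : ℝ} {m : ℤ}

/-- The level changes sides of `h` only by entering the necklace, which the orbit never leaves. -/
theorem level_le_iff_or_inNecklace (hg : Grid v ω m) {h B : ℝ} (hB0 : 0 < B)
    (hB : ∀ i, ‖v i‖ ≤ B) {N : ℤ} (hN : h = 2 * m ^ 2 * ω * N) (hh : 8 * B ^ 2 ≤ h)
    (hh' : 100 * B ^ 4 ≤ h * ω) {s : ℕ → Plane} {a : ℕ → Fin p} (ho : RegularOrbit v s a) (k : ℕ) :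
    (level v (a k) (a (k + 1)) (s k) ≤ h ↔ level v (a 0) (a 1) (s 0) ≤ h) ∨
      InNecklace v ω m h s k := by
  have hpos : 0 < h := lt_of_lt_of_le (by positivity) hh
  have hB4 : 0 ≤ B ^ 4 := by positivity
  induction k with
  | zero => exact Or.inl Iff.rfl
  | succ k ih =>
    rcases ih with ih | ih
    · by_cases hcr : (level v (a k) (a (k + 1)) (s k) ≤ h ↔
        level v (a (k + 1)) (a (k + 2)) (s (k + 1)) ≤ h)
      · exact Or.inl (hcr.symm.trans ih)
      · exact Or.inr (inNecklace_of_crossing hg hB0 hB hN hpos hh' ho hcr)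
    · exact Or.inr (ih.succ hg hB hN hpos hh (by linarith) ho)

variable [NeZero p]

theorem RegularOrbit.abs_level_sub_width_le {B : ℝ} (hB : ∀ i, ‖v i‖ ≤ B) {s : ℕ → Plane}
    {a : ℕ → Fin p} (ho : RegularOrbit v s a) (k : ℕ) :
    |level v (a k) (a (k + 1)) (s k) - width v (s k)| ≤ 10 * B ^ 2 :=
  OuterBilliard.abs_level_sub_width_le hB (ho.mem k) (ho.succ k ▸ ho.mem (k + 1))

/-- The width varies along a regular orbit by a bounded amount. -/
theorem Grid.exists_width_confined (hg : Grid v ω m) : ∃ C, 0 < C ∧ ∀ s a, RegularOrbit v s a →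
    ∀ k, |width v (s k) - width v (s 0)| ≤ C := by
  obtain ⟨B, hB0, hB⟩ := exists_norm_le v
  have hω := hg.unit_pos
  have hm : (0 : ℝ) < m := by exact_mod_cast hg.mult_pos
  set κ := 2 * m ^ 2 * ω with hκ
  have hκ0 : 0 < κ := by positivity
  set H := 8 * B ^ 2 + 100 * B ^ 4 / ω with hH
  have hH0 : 0 < H := by positivity
  have hB2 : 0 < B ^ 2 := by positivity
  refine ⟨30 * B ^ 2 + H + κ, by positivity, fun s a ho k => ?_⟩
  have good : ∀ h, H ≤ h → 8 * B ^ 2 ≤ h ∧ 100 * B ^ 4 ≤ h * ω := fun h hh => by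
    have h1 : 0 ≤ 100 * B ^ 4 / ω := by positivity
    refine ⟨by linarith, ?_⟩
    rw [← div_le_iff₀ hω]
    linarith
  have l0 := abs_le.1 (ho.abs_level_sub_width_le hB 0)
  have lk := abs_le.1 (ho.abs_level_sub_width_le hB k)
  rw [zero_add] at l0
  set ℓ := level v (a 0) (a 1) (s 0)
  have w0 := width_nonneg v (s 0)
  have wk := width_nonneg v (s k)
  rw [abs_le]
  constructor
  · rcases le_or_gt ℓ (H + κ) with hle | hgt
    · linarith [l0.1]
    -- The highest necklace height strictly below `ℓ`: strictly, because sides are recorded by `≤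
    -- h`.
    · set N := ⌈ℓ / κ⌉ - 1 with hN
      have n1 : κ * N < ℓ := by
        have := Int.ceil_lt_add_one (ℓ / κ)
        have h2 : (N : ℝ) < ℓ / κ := by rw [hN]; push_cast; linarith
        rw [lt_div_iff₀ hκ0] at h2
        linarith
      have n2 : ℓ - κ ≤ κ * N := by
        have := Int.le_ceil (ℓ / κ)
        have h2 : ℓ / κ ≤ N + 1 := by rw [hN]; push_cast; linarith
        rw [div_le_iff₀ hκ0] at h2
        linarith
      obtain ⟨g1, g2⟩ := good (κ * N) (by linarith)
      rcases level_le_iff_or_inNecklace hg hB0 hB rfl g1 g2 ho k with hk | hk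
      · have := not_le.1 (fun hcon => not_le.2 n1 (hk.1 hcon))
        linarith [lk.2, l0.1]
      · have := abs_le.1 (hk.abs_width_sub_le hB ho)
        linarith [this.1, l0.1]
  · set N := ⌈max ℓ H / κ⌉ with hN
    have n1 : max ℓ H ≤ κ * N := by
      have := Int.le_ceil (max ℓ H / κ)
      rw [div_le_iff₀ hκ0] at this
      linarith
    have n2 : κ * N ≤ max ℓ H + κ := by
      have := Int.ceil_lt_add_one (max ℓ H / κ)
      rw [← sub_lt_iff_lt_add, lt_div_iff₀ hκ0] at this
      linarith
    have n3 : max ℓ H ≤ ℓ + 10 * B ^ 2 + H := max_le (by linarith) (by linarith [l0.1])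
    obtain ⟨g1, g2⟩ := good (κ * N) ((le_max_right _ _).trans n1)
    rcases level_le_iff_or_inNecklace hg hB0 hB rfl g1 g2 ho k with hk | hk
    · have := hk.2 ((le_max_left _ _).trans n1)
      linarith [lk.1, l0.2]
    · have := abs_le.1 (hk.abs_width_sub_le hB ho)
      linarith [this.2, l0.2]

end Confinement

/-! ### Linear return times by pigeonhole. -/

section Counting

variable {p : ℕ} {v : Fin p → Plane} {ω : ℝ} {m : ℤ}

theorem Nondegenerate.exists_cross_ne_zero (hv : Nondegenerate v) {u : Plane} (hu : u ≠ 0) :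
    ∃ k l, cross u (v l - v k) ≠ 0 := by
  obtain ⟨a, b, c, h⟩ := hv
  by_contra! hcon
  refine hu (eq_zero_of_cross_eq_zero h ?_ ?_)
  · rw [cross_swap, hcon, neg_zero]
  · rw [cross_swap, hcon, neg_zero]

theorem RegularOrbit.exists_int (hg : Grid v ω m) {s : ℕ → Plane} {a : ℕ → Fin p}
    (ho : RegularOrbit v s a) (i j : Fin p) (k : ℕ) :
    ∃ z : ℤ, cross (v j - v i) (s (2 * k)) = cross (v j - v i) (s 0) + z * ω := by
  induction k with
  | zero => exact ⟨0, by simp⟩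
  | succ k ih =>
    obtain ⟨z, hz⟩ := ih
    obtain ⟨n, hn, -⟩ := hg.int i j (a (2 * k)) (a (2 * k + 1))
    refine ⟨z + 2 * n, ?_⟩
    rw [show 2 * (k + 1) = 2 * k + 2 from rfl, ho.add_two, cross_add_right, cross_smul_right, hz, hn]
    push_cast
    ring

variable [NeZero p]

/-- Regular orbits are periodic, with a period bounded linearly. -/
theorem Grid.exists_returnTime_le (hg : Grid v ω m) (hv : Nondegenerate v) :
    ∃ C : ℝ, 0 < C ∧ ∀ s a, RegularOrbit v s a →
      ∃ n ∈ returnTimes v (s 0), (n : ℝ) ≤ C * (width v (s 0) + 1) := by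
  have hω := hg.unit_pos
  obtain ⟨C₀, hC₀, hconf⟩ := hg.exists_width_confined
  obtain ⟨w, hw, hwid⟩ := hv.exists_le_width
  have he : ∀ i j, ∃ q : Fin p × Fin p,
      v j - v i ≠ 0 → cross (v j - v i) (v q.2 - v q.1) ≠ 0 := fun i j => by
    by_cases h : v j - v i = 0
    -- A dummy partner: a zero difference realizes the width only at the origin.
    · exact ⟨(0, 0), fun h' => absurd h h'⟩
    · obtain ⟨k, l, hkl⟩ := hv.exists_cross_ne_zero h
      exact ⟨(k, l), fun _ => hkl⟩
  choose e he using he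
  set A : ℕ := ⌈2 * C₀ / ω⌉₊ + 1 with hA
  set K : ℝ := (4 + 2 * C₀) / ω + 3 with hK
  have hK0 : 0 < K := by positivity
  have hp : (0 : ℝ) < p := by exact_mod_cast Nat.pos_of_neZero p
  refine ⟨2 * (p * p * ((A + 1) * K)), by positivity, fun s a ho => ?_⟩
  choose Z hZ using fun k i j => ho.exists_int hg i j k
  choose c d hcd using fun k => exists_width_eq v (s (2 * k))
  set r := width v (s 0)
  have hr : 0 ≤ r := width_nonneg v _
  set E : ℕ := ⌈(2 * r + C₀) / ω⌉₊ with hE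
  -- An even point is coded by a pair realizing its width, by that width in units of `ω` from about
  -- the bottom of its confinement interval (boundedly many values), and by an independent
  -- coordinate (linearly many).
  let f : ℕ → (Fin p × Fin p) × (ℤ × ℤ) := fun k => ((c k, d k),
    (Z k (c k) (d k) - ⌊(r - C₀ - cross (v (d k) - v (c k)) (s 0)) / ω⌋,
      Z k (e (c k) (d k)).1 (e (c k) (d k)).2))
  let T : Finset ((Fin p × Fin p) × (ℤ × ℤ)) :=
    Finset.univ ×ˢ (Finset.Icc (0 : ℤ) A ×ˢ Finset.Icc (-E : ℤ) E)
  have hTcard : T.card = p * p * ((A + 1) * (2 * E + 1)) := by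
    simp only [T, Finset.card_product, Finset.card_univ, Fintype.card_prod, Fintype.card_fin,
      Int.card_Icc]
    congr 2
    omega
  have hmaps : ∀ k, f k ∈ T := fun k => by
    have h1 := abs_le.1 (hconf s a ho (2 * k))
    have h2 := hZ k (c k) (d k)
    rw [hcd] at h2
    have h3 := hZ k (e (c k) (d k)).1 (e (c k) (d k)).2
    have b1 := abs_le.1 (abs_cross_le_width v (e (c k) (d k)).1 (e (c k) (d k)).2
      (s (2 * k)))
    have b2 := abs_le.1 (abs_cross_le_width v (e (c k) (d k)).1 (e (c k) (d k)).2 (s 0))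
    simp only [T, f, Finset.mem_product, Finset.mem_univ, true_and, Finset.mem_Icc]
    refine ⟨⟨?_, ?_⟩, ?_, ?_⟩
    · rw [sub_nonneg, ← Int.cast_le (R := ℝ)]
      refine (Int.floor_le _).trans ?_
      rw [div_le_iff₀ hω]
      linarith [h1.1]
    · rw [← Int.cast_le (R := ℝ)]
      have h4 := Int.lt_floor_add_one ((r - C₀ - cross (v (d k) - v (c k)) (s 0)) / ω)
      have h5 := Nat.le_ceil (2 * C₀ / ω)
      have h6 : (Z k (c k) (d k) : ℝ) ≤
          (r - C₀ - cross (v (d k) - v (c k)) (s 0)) / ω + 2 * C₀ / ω := by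
        rw [← add_div, le_div_iff₀ hω]
        linarith [h1.2]
      rw [hA]
      push_cast
      linarith
    · rw [← Int.cast_le (R := ℝ)]
      have h5 := Nat.le_ceil ((2 * r + C₀) / ω)
      rw [← hE, div_le_iff₀ hω] at h5
      push_cast
      by_contra! hcon
      nlinarith [h1.2, b1.1, b2.2]
    · rw [← Int.cast_le (R := ℝ)]
      have h5 := Nat.le_ceil ((2 * r + C₀) / ω)
      rw [← hE, div_le_iff₀ hω] at h5
      push_cast
      by_contra! hcon
      nlinarith [h1.2, b1.2, b2.1]
  have hinj : ∀ k l, f k = f l → s (2 * k) = s (2 * l) := fun k l hkl => by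
    simp only [f, Prod.mk.injEq] at hkl
    obtain ⟨⟨hc, hd⟩, h1, h2⟩ := hkl
    rw [← hc, ← hd] at h1 h2
    have h1 := sub_left_injective h1
    have hk := hcd k
    have hl := hcd l
    rw [← hc, ← hd] at hl
    by_cases h0 : v (d k) - v (c k) = 0
    · rw [h0, cross_zero_left] at hk hl
      have zk : s (2 * k) = 0 := norm_le_zero_iff.1 (by
        have := hwid (s (2 * k)); rw [← hk] at this; exact nonpos_of_mul_nonpos_right this hw)
      have zl : s (2 * l) = 0 := norm_le_zero_iff.1 (by
        have := hwid (s (2 * l)); rw [← hl] at this; exact nonpos_of_mul_nonpos_right this hw)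
      rw [zk, zl]
    · refine sub_eq_zero.1 (eq_zero_of_cross_eq_zero (he _ _ h0) ?_ ?_)
      · rw [cross_sub_right, hZ k, hZ l, h1, sub_self]
      · rw [cross_sub_right, hZ k, hZ l, h2, sub_self]
  obtain ⟨k, hk, l, hl, hne, hkl⟩ := Finset.exists_ne_map_eq_of_card_lt_of_maps_to
    (s := Finset.range (T.card + 1)) (t := T) (f := f) (by simp) (fun k _ => hmaps k)
  have main : ∀ k l, k < l → l ≤ T.card → f k = f l →
      ∃ n ∈ returnTimes v (s 0), (n : ℝ) ≤ 2 * (p * p * ((A + 1) * K)) * (r + 1) := by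
    intro k l hlt hl hkl
    refine ⟨2 * l - 2 * k, ho.mem_returnTimes (by omega) (hinj k l hkl), ?_⟩
    have h1 : 2 * l - 2 * k ≤ 2 * (p * p * ((A + 1) * (2 * E + 1))) := by
      rw [← hTcard]; omega
    have h2 : (2 * E + 1 : ℝ) ≤ K * (r + 1) := by
      have h3 := Nat.ceil_lt_add_one (a := (2 * r + C₀) / ω) (by positivity)
      have h4 : K * (r + 1) = 2 * ((2 * r + C₀) / ω + 1) + 1 + (4 + 2 * C₀ * r) / ω + 3 * r := by
        rw [hK]; field_simp; ring
      have h5 : 0 ≤ (4 + 2 * C₀ * r) / ω := by positivity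
      rw [h4]
      linarith
    calc ((2 * l - 2 * k : ℕ) : ℝ) ≤ ((2 * (p * p * ((A + 1) * (2 * E + 1))) : ℕ) : ℝ) := by
          exact_mod_cast h1
      _ = 2 * (p * p * ((A + 1) * (2 * E + 1))) := by push_cast; ring
      _ ≤ 2 * (p * p * ((A + 1) * (K * (r + 1)))) := by gcongr
      _ = _ := by ring
  rw [Finset.mem_range] at hk hl
  rcases lt_or_gt_of_ne hne with h | h
  · exact main k l h (by omega) hkl
  · exact main l k h (by omega) hkl.symm

end Counting

/-! ### Rationality provides the grid. -/

section Rational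

variable {p : ℕ} [NeZero p] {v : Fin p → Plane}

theorem diff_mem_span_sides (i j : Fin p) :
    v j - v i ∈ Submodule.span ℤ (Set.range fun i : Fin p => v (i + 1) - v i) := by
  have h : ∀ n : ℕ, v (Fin.ofNat p n) - v 0 ∈
      Submodule.span ℤ (Set.range fun i : Fin p => v (i + 1) - v i) := fun n => by
    induction n with
    | zero =>
      rw [show Fin.ofNat p 0 = 0 from rfl, sub_self]
      exact zero_mem _
    | succ n ih =>
      have e : Fin.ofNat p (n + 1) = Fin.ofNat p n + 1 := by
        ext; simp [Fin.val_add]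
      have : v (Fin.ofNat p (n + 1)) - v 0 =
          (v (Fin.ofNat p n + 1) - v (Fin.ofNat p n)) + (v (Fin.ofNat p n) - v 0) := by
        rw [e]; abel
      rw [this]
      exact add_mem (Submodule.subset_span ⟨_, rfl⟩) ih
  have hj := h j
  have hi := h i
  rw [Fin.ofNat_val_eq_self] at hi hj
  have : v j - v i = (v j - v 0) - (v i - v 0) := by abel
  rw [this]
  exact sub_mem hj hi

/-- In a basis of the rank-two group, areas are integer determinants times the area of the basis,
which is nonzero by nondegeneracy. -/
theorem IsRationalPolygon.exists_grid (hv : Nondegenerate v) (hr : IsRationalPolygon v) :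
    ∃ ω m, Grid v ω m := by
  unfold IsRationalPolygon at hr
  have hmem := diff_mem_span_sides (v := v)
  set Λ := Submodule.span ℤ (Set.range fun i : Fin p => v (i + 1) - v i)
  have : Module.Finite ℤ Λ := Module.Finite.span_of_finite ℤ (Set.finite_range _)
  have : IsAddTorsionFree Plane := .of_module_rat _
  let β := Module.finBasisOfFinrankEq ℤ Λ hr
  have hrep : ∀ u ∈ Λ, ∃ x y : ℤ, u = (x : ℝ) • (β 0 : Plane) + (y : ℝ) • (β 1 : Plane) := by
    intro u hu
    refine ⟨β.repr ⟨u, hu⟩ 0, β.repr ⟨u, hu⟩ 1, ?_⟩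
    have := congrArg Subtype.val (β.sum_repr ⟨u, hu⟩)
    rw [Fin.sum_univ_two] at this
    rw [Int.cast_smul_eq_zsmul, Int.cast_smul_eq_zsmul]
    exact this.symm
  have hint : ∀ u ∈ Λ, ∀ w ∈ Λ, ∃ n : ℤ, cross u w = n * cross (β 0 : Plane) (β 1) := by
    intro u hu w hw
    obtain ⟨x, y, rfl⟩ := hrep u hu
    obtain ⟨x', y', rfl⟩ := hrep w hw
    refine ⟨x * y' - y * x', ?_⟩
    simp only [cross, PiLp.add_apply, PiLp.smul_apply, smul_eq_mul]
    push_cast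
    ring
  have hne : cross (β 0 : Plane) (β 1) ≠ 0 := fun h0 => by
    obtain ⟨a, b, c, h⟩ := hv
    obtain ⟨n, hn⟩ := hint _ (hmem a b) _ (hmem a c)
    rw [h0, mul_zero] at hn
    exact h hn
  refine ⟨|cross (β 0 : Plane) (β 1)|, OuterBilliard.exists_grid (abs_pos.2 hne)
    fun i j k l => ?_⟩
  obtain ⟨n, hn⟩ := hint _ (hmem i j) _ (hmem k l)
  rcases abs_cases (cross (β 0 : Plane) (β 1)) with h | h
  · exact ⟨n, by rw [h.1, hn]⟩
  · exact ⟨-n, by rw [h.1, hn]; push_cast; ring⟩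

/-- Regular points of a rational polygon are periodic, with a period bounded linearly. -/
theorem IsRationalPolygon.exists_period_le (hv : IsConvexPolygon v) (hr : IsRationalPolygon v) :
    ∃ C : ℝ, 0 < C ∧ ∀ x ∈ regularPoints v,
      x ∈ periodicPoints v ∧ (period v x : ℝ) ≤ C * (‖x‖ + 1) := by
  obtain ⟨ω, m, hg⟩ := hr.exists_grid hv.nondegenerate
  obtain ⟨C, hC, h⟩ := hg.exists_returnTime_le hv.nondegenerate
  obtain ⟨B, hB0, hB⟩ := exists_norm_le v
  refine ⟨C * (2 * B + 1), by positivity, fun x hx => ?_⟩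
  obtain ⟨s, a, rfl, ho⟩ := IsRegular.exists_regularOrbit hv hx
  obtain ⟨n, hn, hle⟩ := h s a ho
  refine ⟨⟨n, hn⟩, ?_⟩
  have h1 : (period v (s 0) : ℝ) ≤ n := by exact_mod_cast Nat.sInf_le hn
  have h2 := width_le_norm hB (s 0)
  calc (period v (s 0) : ℝ) ≤ C * (width v (s 0) + 1) := h1.trans hle
    _ ≤ C * (2 * B * ‖s 0‖ + 1) := by gcongr
    _ ≤ C * ((2 * B + 1) * (‖s 0‖ + 1)) := by
      gcongr
      nlinarith [norm_nonneg (s 0)]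
    _ = _ := by ring

end Rational

/-! ### Irregular points form a null set. -/

section NullSet

variable {p : ℕ} {v : Fin p → Plane}

/-- The composition of the reflections in a list of vertices. -/
def reflections (v : Fin p → Plane) (l : List (Fin p)) (x : Plane) : Plane :=
  l.foldl (fun y i => (2 : ℝ) • v i - y) x

theorem exists_reflections_eq {x y : Plane} (h : Relation.ReflTransGen (Step v) x y) :
    ∃ l, y = reflections v l x := by
  induction h with
  | refl => exact ⟨[], rfl⟩
  | tail _ hs ih =>
    obtain ⟨l, rfl⟩ := ih
    obtain ⟨i, -, rfl⟩ := hs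
    exact ⟨l ++ [i], by simp [reflections]⟩

theorem volume_preimage_reflections {A : Set Plane} (hA : volume A = 0) (l : List (Fin p)) :
    volume (reflections v l ⁻¹' A) = 0 := by
  induction l with
  | nil => exact hA
  | cons i l ih =>
    exact (Measure.measurePreserving_sub_left volume ((2 : ℝ) • v i)).quasiMeasurePreserving.preimage_null ih

variable [NeZero p]

theorem IsConvexPolygon.volume_ray (hv : IsConvexPolygon v) (i : Fin p) :
    volume (ray v i) = 0 := by
  obtain ⟨j, hj⟩ := hv.exists_side_pos i
  have hker : LinearMap.ker (crossL (v (i + 1) - v i)) ≠ ⊤ := fun h => by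
    have : v j - v i ∈ LinearMap.ker (crossL (v (i + 1) - v i)) := h ▸ Submodule.mem_top
    rw [LinearMap.mem_ker, crossL_apply] at this
    exact hj.ne' this
  have h0 := Measure.addHaar_submodule volume _ hker
  have h1 := (measurePreserving_sub_right volume (v i)).quasiMeasurePreserving.preimage_null h0
  refine measure_mono_null ?_ h1
  rintro _ ⟨t, -, rfl⟩
  simp only [Set.mem_preimage, SetLike.mem_coe, LinearMap.mem_ker, crossL_apply]
  rw [add_sub_cancel_left, cross_smul_right, ← neg_sub (v i), cross_neg_left, cross_self]
  simp

/-- Almost every point outside the polygon is regular. -/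
theorem IsConvexPolygon.volume_not_regular (hv : IsConvexPolygon v) :
    volume (phaseSpace v \ regularPoints v) = 0 := by
  -- Reachable points are images of `x` under countably many compositions of reflections, each
  -- preserving null sets under preimage.
  refine measure_mono_null (t := ⋃ l : List (Fin p), ⋃ i, reflections v l ⁻¹' ray v i) ?_
    (measure_iUnion_null fun l => measure_iUnion_null fun i =>
      volume_preimage_reflections (hv.volume_ray i) l)
  rintro x ⟨hx, hreg⟩
  by_contra hcon
  simp only [Set.mem_iUnion, Set.mem_preimage, not_exists] at hcon
  refine hreg fun y hy => ?_
  have off : ∀ y, Relation.ReflTransGen (Step v) x y → ∀ i, y ∉ ray v i := fun y hy i => by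
    obtain ⟨l, rfl⟩ := exists_reflections_eq hy
    exact hcon l i
  refine ⟨?_, off y hy⟩
  induction hy with
  | refl => exact hx
  | tail h hs ih =>
    obtain ⟨i, hi, rfl⟩ := hs
    exact hv.reflect_mem_phaseSpace hi (off _ h)

end NullSet

/-! ### Measurability of the sets of bounded period. -/

section Measurability

variable {p : ℕ} {v : Fin p → Plane}

theorem measurableSet_cell (i : Fin p) : MeasurableSet (cell v i) := by
  have : cell v i = phaseSpace v ∩ ⋂ j, {x | 0 ≤ cross (v i - x) (v j - x)} := by
    ext x; simp [cell]
  rw [this]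
  refine isCompact_body.isClosed.measurableSet.compl.inter (MeasurableSet.iInter fun j => ?_)
  refine (isClosed_le continuous_const ?_).measurableSet
  exact continuous_cross.comp (by fun_prop : Continuous fun x : Plane => (v i - x, v j - x))

/-- The pairs of points joined by an orbit segment of a given length. -/
def reach (v : Fin p → Plane) : ℕ → Set (Plane × Plane)
  | 0 => {z | z.1 = z.2}
  | n + 1 => ⋃ i, {z | z.1 ∈ cell v i} ∩ (fun z => ((2 : ℝ) • v i - z.1, z.2)) ⁻¹' reach v n

theorem measurableSet_reach (n : ℕ) : MeasurableSet (reach v n) := by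
  induction n with
  | zero => exact (isClosed_eq continuous_fst continuous_snd).measurableSet
  | succ n ih =>
    refine MeasurableSet.iUnion fun i => ((measurableSet_cell i).preimage measurable_fst).inter
      (ih.preimage ?_)
    fun_prop

theorem mem_reach_iff {n : ℕ} {x y : Plane} : (x, y) ∈ reach v n ↔
    ∃ s : ℕ → Plane, s 0 = x ∧ s n = y ∧ ∀ k < n, Step v (s k) (s (k + 1)) := by
  induction n generalizing x with
  | zero =>
    constructor
    · intro h
      exact ⟨fun _ => x, rfl, h, by simp⟩
    · rintro ⟨s, rfl, rfl, -⟩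
      rfl
  | succ n ih =>
    simp only [reach, Set.mem_iUnion]
    constructor
    · rintro ⟨i, hi, h⟩
      obtain ⟨s, h0, hn, hs⟩ := ih.1 h
      refine ⟨fun k => Nat.casesOn k x s, rfl, hn, fun k hk => ?_⟩
      cases k with
      | zero => exact ⟨i, hi, h0⟩
      | succ k => exact hs k (by omega)
    · rintro ⟨s, rfl, rfl, hs⟩
      obtain ⟨i, hi, e⟩ := hs 0 (by omega)
      exact ⟨i, hi, ih.2 ⟨fun k => s (k + 1), e, rfl, fun k hk => hs (k + 1) (by omega)⟩⟩

/-- Period at most `n` means a return at some time in `(0, n]`, so minimality of the period plays no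
role. -/
theorem measurableSet_periodAtMost (n : ℕ) : MeasurableSet (periodAtMost v n) := by
  have : periodAtMost v n =
      ⋃ k ∈ Set.Ioc 0 n, (fun x : Plane => (x, x)) ⁻¹' reach v k := by
    ext x
    simp only [Set.mem_iUnion, Set.mem_preimage, mem_reach_iff]
    constructor
    · rintro ⟨hx, hn⟩
      have := period_mem hx
      exact ⟨_, ⟨this.1, hn⟩, this.2⟩
    · rintro ⟨k, ⟨h0, hk⟩, h⟩
      have : k ∈ returnTimes v x := ⟨h0, h⟩
      exact ⟨⟨k, this⟩, (Nat.sInf_le this).trans hk⟩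
  rw [this]
  refine MeasurableSet.biUnion (Set.to_countable _) fun k _ => (measurableSet_reach k).preimage ?_
  fun_prop

end Measurability

/-! ### Quadratic growth of area. -/

section Area

variable {p : ℕ} [NeZero p] {v : Fin p → Plane}

theorem volume_real_ball_pos : 0 < volume.real (Metric.ball (0 : Plane) 1) :=
  ENNReal.toReal_pos (Metric.measure_ball_pos _ _ one_pos).ne' measure_ball_lt_top.ne

theorem volume_real_ball {r : ℝ} (hr : 0 ≤ r) :
    volume.real (Metric.ball (0 : Plane) r) = r ^ 2 * volume.real (Metric.ball (0 : Plane) 1) := by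
  rw [measureReal_def, Measure.addHaar_ball _ _ hr, finrank_euclideanSpace_fin, ENNReal.toReal_mul,
    ENNReal.toReal_ofReal (by positivity), measureReal_def]

theorem Nondegenerate.periodAtMost_subset (hv : Nondegenerate v) :
    ∃ C, 0 < C ∧ ∀ n : ℕ, periodAtMost v n ⊆ Metric.ball 0 (C * (n + 1)) := by
  obtain ⟨C, hC, h⟩ := hv.norm_le_period
  refine ⟨C, hC, fun n x hx => ?_⟩
  rw [mem_ball_zero_iff]
  have h1 : (period v x : ℝ) ≤ n := by exact_mod_cast hx.2
  calc ‖x‖ ≤ C * period v x := h x hx.1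
    _ ≤ C * n := by gcongr
    _ < C * (n + 1) := by gcongr; linarith

theorem Nondegenerate.volume_periodAtMost_lt_top (hv : Nondegenerate v) (n : ℕ) :
    volume (periodAtMost v n) < ⊤ := by
  obtain ⟨C, -, h⟩ := hv.periodAtMost_subset
  exact (measure_mono (h n)).trans_lt measure_ball_lt_top

theorem Nondegenerate.isBigO_volume (hv : Nondegenerate v) :
    (fun n : ℕ => volume.real (periodAtMost v n)) =O[atTop] fun n : ℕ => (n : ℝ) ^ 2 := by
  obtain ⟨C, hC, h⟩ := hv.periodAtMost_subset
  have hb := volume_real_ball_pos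
  refine IsBigO.of_bound (4 * C ^ 2 * volume.real (Metric.ball (0 : Plane) 1)) ?_
  filter_upwards [eventually_ge_atTop 1] with n hn
  have hn' : (1 : ℝ) ≤ n := by exact_mod_cast hn
  rw [Real.norm_of_nonneg measureReal_nonneg, Real.norm_of_nonneg (by positivity)]
  calc volume.real (periodAtMost v n) ≤ volume.real (Metric.ball (0 : Plane) (C * (n + 1))) :=
        measureReal_mono (h n) measure_ball_lt_top.ne
    _ = (C * (n + 1)) ^ 2 * volume.real (Metric.ball (0 : Plane) 1) :=
        volume_real_ball (by positivity)
    _ ≤ (C * (2 * n)) ^ 2 * volume.real (Metric.ball (0 : Plane) 1) := by gcongr; linarith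
    _ = _ := by ring

theorem IsRationalPolygon.isBigO_sq (hv : IsConvexPolygon v) (hr : IsRationalPolygon v) :
    (fun n : ℕ => (n : ℝ) ^ 2) =O[atTop] fun n : ℕ => volume.real (periodAtMost v n) := by
  obtain ⟨C, hC, h⟩ := hr.exists_period_le hv
  set c := volume.real (Metric.ball (0 : Plane) 1)
  have hc : 0 < c := volume_real_ball_pos
  set A := volume.real (body v)
  have hA : 0 ≤ A := measureReal_nonneg
  have hball : ∀ n : ℕ, 2 * C ≤ n →
      c * (n / (2 * C)) ^ 2 ≤ volume.real (periodAtMost v n) + A := fun n hn => by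
    have hsub : Metric.ball (0 : Plane) (n / (2 * C)) ⊆
        (periodAtMost v n ∪ body v) ∪ (phaseSpace v \ regularPoints v) := fun x hx => by
      rw [mem_ball_zero_iff] at hx
      by_cases h1 : x ∈ body v
      · exact Or.inl (Or.inr h1)
      by_cases h2 : x ∈ regularPoints v
      · obtain ⟨hper, hle⟩ := h x h2
        refine Or.inl (Or.inl ⟨hper, ?_⟩)
        have h3 : C * (‖x‖ + 1) ≤ n := by
          have h4 : C * ‖x‖ ≤ C * (n / (2 * C)) := by gcongr
          have h5 : C * (n / (2 * C)) = n / 2 := by field_simp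
          linarith
        exact_mod_cast hle.trans h3
      · exact Or.inr ⟨h1, h2⟩
    have h0 : volume.real (phaseSpace v \ regularPoints v) = 0 := by
      rw [measureReal_def, hv.volume_not_regular, ENNReal.toReal_zero]
    have hfin : volume (periodAtMost v n ∪ body v) ≠ ⊤ :=
      measure_union_ne_top (hv.nondegenerate.volume_periodAtMost_lt_top n).ne
        isCompact_body.measure_lt_top.ne
    calc c * (n / (2 * C)) ^ 2 = volume.real (Metric.ball (0 : Plane) (n / (2 * C))) := by
          rw [volume_real_ball (by positivity), mul_comm]
      _ ≤ volume.real ((periodAtMost v n ∪ body v) ∪ (phaseSpace v \ regularPoints v)) :=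
          measureReal_mono hsub (measure_union_ne_top hfin (by simp [hv.volume_not_regular]))
      _ ≤ volume.real (periodAtMost v n ∪ body v) +
            volume.real (phaseSpace v \ regularPoints v) := measureReal_union_le _ _
      _ ≤ volume.real (periodAtMost v n) + A := by
          rw [h0, add_zero]
          exact measureReal_union_le _ _
  -- Twice the natural constant `4 * C ^ 2 / c`; the spare half absorbs the area of the polygon.
  refine IsBigO.of_bound (8 * C ^ 2 / c) ?_
  have hlarge : ∀ᶠ n : ℕ in atTop, 8 * C ^ 2 * A / c + 1 ≤ n :=
    tendsto_natCast_atTop_atTop.eventually_ge_atTop _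
  filter_upwards [hlarge, tendsto_natCast_atTop_atTop.eventually_ge_atTop (2 * C)] with n h1 h2
  rw [Real.norm_of_nonneg measureReal_nonneg, Real.norm_of_nonneg (by positivity)]
  have h3 := hball n h2
  have h4 : 8 * C ^ 2 * A / c ≤ (n : ℝ) ^ 2 := by
    have : 0 ≤ 8 * C ^ 2 * A / c := by positivity
    nlinarith
  rw [div_le_iff₀ hc] at h4
  rw [div_mul_eq_mul_div, le_div_iff₀ hc]
  have h5 : 4 * C ^ 2 * (c * (n / (2 * C)) ^ 2) = n ^ 2 * c := by field_simp; ring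
  nlinarith [sq_nonneg C]

end Area

/-! ### Comparison of an arbitrary norm with the Euclidean one. -/

section Norms

theorem exists_seminorm_le (N : Seminorm ℝ Plane) : ∃ C, 0 < C ∧ ∀ x, N x ≤ C * ‖x‖ := by
  refine ⟨N (EuclideanSpace.single 0 1) + N (EuclideanSpace.single 1 1) + 1,
    by linarith [apply_nonneg N (EuclideanSpace.single 0 1),
      apply_nonneg N (EuclideanSpace.single 1 1)], fun x => ?_⟩
  have e : x = x 0 • EuclideanSpace.single (0 : Fin 2) (1 : ℝ) +
      x 1 • EuclideanSpace.single (1 : Fin 2) (1 : ℝ) := by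
    ext i; fin_cases i <;> simp
  have h1 : N x ≤ |x 0| * N (EuclideanSpace.single 0 1) + |x 1| * N (EuclideanSpace.single 1 1) := by
    conv_lhs => rw [e]
    refine (map_add_le_add N _ _).trans ?_
    rw [map_smul_eq_mul, map_smul_eq_mul, Real.norm_eq_abs, Real.norm_eq_abs]
  have h2 : |x 0| ≤ ‖x‖ := PiLp.norm_apply_le x 0
  have h3 : |x 1| ≤ ‖x‖ := PiLp.norm_apply_le x 1
  nlinarith [apply_nonneg N (EuclideanSpace.single 0 1),
    apply_nonneg N (EuclideanSpace.single 1 1), norm_nonneg x]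

/-- The constant is the inverse of the positive minimum of `N` on the unit circle. -/
theorem exists_norm_le_seminorm (N : Seminorm ℝ Plane) (hN : ∀ x, N x = 0 → x = 0) :
    ∃ C, 0 < C ∧ ∀ x, ‖x‖ ≤ C * N x := by
  obtain ⟨C, hC, hle⟩ := exists_seminorm_le N
  have hcont : Continuous N := by
    refine (LipschitzWith.of_le_add_mul ⟨C, hC.le⟩ fun x y => ?_).continuous
    have h1 := map_add_le_add N (x - y) y
    rw [sub_add_cancel] at h1
    have h2 := hle (x - y)
    rw [dist_eq_norm]
    change N x ≤ N y + C * _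
    linarith
  obtain ⟨x₀, hx₀, hmin⟩ := (isCompact_sphere (0 : Plane) 1).exists_isMinOn
    (NormedSpace.sphere_nonempty.2 zero_le_one) hcont.continuousOn
  have hx₀' : ‖x₀‖ = 1 := by simpa using hx₀
  have hpos : 0 < N x₀ := lt_of_le_of_ne (apply_nonneg N x₀) fun h => by
    rw [hN x₀ h.symm, norm_zero] at hx₀'
    exact zero_ne_one hx₀'
  refine ⟨(N x₀)⁻¹, by positivity, fun x => ?_⟩
  rw [inv_mul_eq_div, le_div_iff₀ hpos]
  by_cases hx : x = 0
  · simp [hx]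
  have hx' : 0 < ‖x‖ := norm_pos_iff.2 hx
  have hs : ‖x‖⁻¹ • x ∈ Metric.sphere (0 : Plane) 1 := by
    simp [norm_smul, hx'.ne']
  have h1 : N x₀ ≤ N (‖x‖⁻¹ • x) := hmin hs
  rw [map_smul_eq_mul, norm_inv, norm_norm, inv_mul_eq_div, le_div_iff₀ hx'] at h1
  linarith

end Norms

end OuterBilliard

/-- `N` is an arbitrary norm on the plane; `comap N atTop ⊓ 𝓟 Y` is the filter "`N x → ∞`,
`x ∈ Y`", so that for nonnegative functions `=O` and `=Θ` along it are the two growth relations. -/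
theorem proposition7 {p : ℕ} [NeZero p] (v : Fin p → OuterBilliard.Plane)
    (hv : OuterBilliard.IsConvexPolygon v)
    (N : Seminorm ℝ OuterBilliard.Plane) (hN : ∀ x, N x = 0 → x = 0) :
    ((fun x => N x) =O[comap N atTop ⊓ Filter.principal (OuterBilliard.periodicPoints v)]
        fun x => (OuterBilliard.period v x : ℝ)) ∧
    (OuterBilliard.IsRationalPolygon v →
      OuterBilliard.regularPoints v ⊆ OuterBilliard.periodicPoints v ∧
      ((fun x => (OuterBilliard.period v x : ℝ))
        =Θ[comap N atTop ⊓ Filter.principal (OuterBilliard.regularPoints v)] fun x => N x) ∧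
      (∀ n : ℕ, MeasurableSet (OuterBilliard.periodAtMost v n) ∧
        volume (OuterBilliard.periodAtMost v n) < ⊤) ∧
      ((fun n : ℕ => volume.real (OuterBilliard.periodAtMost v n))
        =Θ[atTop] fun n : ℕ => (n : ℝ) ^ 2)) := by
  have hnd := hv.nondegenerate
  obtain ⟨C₁, hC₁, hper⟩ := hnd.norm_le_period
  obtain ⟨M, hM, hNM⟩ := OuterBilliard.exists_seminorm_le N
  have hlow : ∀ x ∈ OuterBilliard.periodicPoints v,
      ‖N x‖ ≤ M * C₁ * ‖(OuterBilliard.period v x : ℝ)‖ := fun x hx => by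
    rw [Real.norm_of_nonneg (apply_nonneg N x), Real.norm_of_nonneg (Nat.cast_nonneg _), mul_assoc]
    exact (hNM x).trans (mul_le_mul_of_nonneg_left (hper x hx) hM.le)
  refine ⟨IsBigO.of_bound (M * C₁) (eventually_inf_principal.2 (.of_forall hlow)), fun hr => ?_⟩
  obtain ⟨C₂, hC₂, hreg⟩ := hr.exists_period_le hv
  obtain ⟨K, hK, hNK⟩ := OuterBilliard.exists_norm_le_seminorm N hN
  have hup : ∀ᶠ x in comap N atTop, x ∈ OuterBilliard.regularPoints v →
      ‖(OuterBilliard.period v x : ℝ)‖ ≤ C₂ * (K + 1) * ‖N x‖ := by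
    filter_upwards [tendsto_comap.eventually_ge_atTop 1] with x hx hxr
    rw [Real.norm_of_nonneg (apply_nonneg N x), Real.norm_of_nonneg (Nat.cast_nonneg _), mul_assoc]
    refine (hreg x hxr).2.trans (mul_le_mul_of_nonneg_left ?_ hC₂.le)
    linarith [hNK x]
  exact ⟨fun x hx => (hreg x hx).1,
    ⟨IsBigO.of_bound _ (eventually_inf_principal.2 hup),
      IsBigO.of_bound (M * C₁) (eventually_inf_principal.2
        (.of_forall fun x hx => hlow x (hreg x hx).1))⟩,
    fun n => ⟨OuterBilliard.measurableSet_periodAtMost n, hnd.volume_periodAtMost_lt_top n⟩,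
    hnd.isBigO_volume, hr.isBigO_sq hv⟩
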